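/- **Theorem (online maintenance of minimal unique substrings).** For a string $T$ let $\mathrm{occ}_T(S)$ be the number of occurrences of $S$ in $T$ (the empty string occurs $|T|+1$ times). $S$ is *unique* in $T$ if $\mathrm{occ}_T(S)=1$ and *repeating* if $\mathrm{occ}_T(S)\ge 2$. Let $\mathsf{MUS}(T)$ be the set of intervals $[s..t]$, $1\le s\le t\le |T|$, such that $T[s..t]$ is unique in $T$ and every proper substring of $T[s..t]$ is repeating in $T$. Let $\mathrm{LSuf}(T)$ be the longest repeating suffix of $T$ (the empty string if $T$ is empty), and $\mathrm{SSuf}(T)$ the shortest nonempty suffix of $T$ that occurs exactly twice in $T$, if there is one. Let $\mathsf{ST}(T)$ be the suffix tree of the inverted string $T[|T|]\cdots T[1]\$$, where $\$$ is an end marker occurring nowhere else; loci are identified with the strings they spell, and the nodes are the root, the leaves and the branching loci. (1) *Updates.* Let $T$ be a string of length $j\ge 0$, $a$ a letter, $T'=Ta$, $m=|\mathrm{LSuf}(T)|$, $m'=|\mathrm{LSuf}(T')|$. If $\mathrm{SSuf}(T')$ exists, let $[s..q]$, $q\le j$, be its previous (non-suffix) occurrence in $T'$. Then $\mathsf{MUS}(T)\setminus\mathsf{MUS}(T')$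 is $\{[s..q]\}$ if $\mathrm{SSuf}(T')$ exists and is empty otherwise; and $\mathsf{MUS}(T')\setminus\mathsf{MUS}(T)$ consists exactly of * $[j+1-m'..j+1]$, if $m'\le m$; * $[s..q+1]$, if $\mathrm{SSuf}(T')$ exists and no interval of $\mathsf{MUS}(T)$ ends at $q+1$; * $[q-m'..q]$, if $\mathrm{SSuf}(T')$ exists, $q-m'\ge 1$ and no interval of $\mathsf{MUS}(T)$ starts at $q-m'$. In particular each appended letter causes at most one deletion (exactly one if and only if $\mathrm{SSuf}(T')$ exists) and at most three insertions. (2) *Reading off the suffixes.* Let $X$ be the insertion point for $a$ in $\mathsf{ST}(T)$, that is, the longest prefix of the inverted terminated string of $T'$ that is a locus of $\mathsf{ST}(T)$. Then $X$ is $\mathrm{LSuf}(T')$ inverted. If $X$ is a node of $\mathsf{ST}(T)$, then $\mathrm{SSuf}(T')$ does not exist. Otherwise $X$ lies in the interior of an edge of $\mathsf{ST}(T)$ and becomes a node of $\mathsf{ST}(T')$; let $B$ be the lower end of that edge in $\mathsf{ST}(T)$ and $Y$ the parent of $X$ in $\mathsf{ST}(T')$. Then $\mathrm{SSuf}(T')$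 exists if and only if $B$ is a leaf, and in this case $|\mathrm{SSuf}(T')|=|Y|+1$, the locus of the inverted $\mathrm{SSuf}(T')$ lies on the edge from $Y$ to $X$, and $q=|B|-1$, $s=|B|-1-|Y|$ (string depths include the end marker). (3) *Algorithm.* Consider the word RAM with $w$-bit words, with programs independent of $w$, and with the space of a computation measured by the highest memory address used. Let $P$ be an implementation of online suffix tree construction (SuffixUpdate) for texts of length at most $N$ over $\{0,\dots,\sigma-1\}$: it starts with $\mathsf{ST}$ of the empty text; when a letter $a$ is appended to $T$ it turns $\mathsf{ST}(T)$ into $\mathsf{ST}(Ta)$ and returns the insertion point, as a pointer to the highest node of $\mathsf{ST}(T)$ at or below it together with its string depth; and, given a pointer to a node, it returns the parent, the string depth and whether the node is a leaf. Suppose that while the text has length $n$ the operation that led to it and each navigation operation takes at most $t_{\mathrm{SU}}(n)$ steps in the worst case, using only the first $c\,(n+1)$ words of memory. There is a universal constant $C$ such that from every such $P$ one obtains a program $Q$, depending only on the programs of $P$ (not on $w,\sigma,N,t_{\mathrm{SU}},c$), which, whenever $2^w\ge C(c+1)(N+1)$, maintains $\mathsf{MUS}$ of the text read so far online for all texts of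 length at most $N$ over $\{0,\dots,\sigma-1\}$. It initializes in at most $C\,t_{\mathrm{SU}}(0)$ steps and reads the $n$-th letter in at most $C\,t_{\mathrm{SU}}(n)$ steps in the worst case. At any time, given a position $i$ of the text read so far, it returns in at most $C$ steps the end (resp. start) of the interval of $\mathsf{MUS}$ that starts (resp. ends) at $i$, or reports that there is none. While the text has length $n$ it uses only the first $C(c+1)(n+1)$ words of memory. Thus $\mathsf{MUS}(T[1..n])$ is maintained online in $O(n)$ space and $O(t_{\mathrm{SU}})$ worst-case time per letter. -/

import Mathlib

namespace MUSOnline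

/-! ### Strings, minimal unique substrings, longest repeating and shortest double suffixes

Positions are 1-based, as is usual for strings. -/

section Strings

variable {α : Type*} [DecidableEq α]

/-- The number of occurrences of `S` in `T` (the empty string occurs `|T| + 1` times). -/
def occ (T S : List α) : ℕ :=
  ((Finset.range (T.length + 1)).filter (fun i => S <+: T.drop i)).card

/-- The substring `T[s..t]`, with 1-based inclusive bounds (empty if `s = t + 1`). -/
def substr (T : List α) (s t : ℕ) : List α := (T.take t).drop (s - 1)

/-- The suffix of `T` of length `l`, for `l ≤ |T|`. -/
def suf (T : List α) (l : ℕ) : List α := T.drop (T.length - l)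

/-- `S` is unique in `T`. -/
def IsUnique (T S : List α) : Prop := occ T S = 1

/-- `S` is repeating in `T`. -/
def IsRepeating (T S : List α) : Prop := 2 ≤ occ T S

/-- The set of intervals `[s..t]` such that `T[s..t]` is a minimal unique substring of `T`. -/
def MUS (T : List α) : Set (ℕ × ℕ) :=
  {p | 1 ≤ p.1 ∧ p.1 ≤ p.2 ∧ p.2 ≤ T.length ∧
    IsUnique T (substr T p.1 p.2) ∧
    ∀ R : List α, R <:+: substr T p.1 p.2 → R ≠ substr T p.1 p.2 → IsRepeating T R}

/-- The length of the longest repeating suffix of `T`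
(`0` for the empty `T`, where the longest repeating suffix is taken to be the empty string). -/
def lsuf (T : List α) : ℕ := Nat.findGreatest (fun l => 2 ≤ occ T (suf T l)) T.length

/-- `l` is the length of the shortest nonempty suffix of `T` that occurs exactly twice in `T`. -/
def IsSSuf (T : List α) (l : ℕ) : Prop :=
  1 ≤ l ∧ l ≤ T.length ∧ occ T (suf T l) = 2 ∧
    ∀ l', 1 ≤ l' → l' < l → occ T (suf T l') ≠ 2

/-- `[s..q]` is the previous (non-suffix) copy of the shortest suffix of `T` that occurs exactly
twice in `T`. -/
def IsSSufCopy (T : List α) (s q : ℕ) : Prop :=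
  1 ≤ s ∧ s ≤ q ∧ q < T.length ∧ IsSSuf T (q + 1 - s) ∧ substr T s q = suf T (q + 1 - s)

end Strings

/-! ### Suffix trees

A locus of the suffix tree of `S` is identified with the string that it spells, a substring of `S`.
The suffix tree that is maintained while `T` is read is the one of the inverted text, terminated by
the end marker `none` that occurs nowhere else, so that its suffixes correspond to its leaves. -/

section SuffixTree

variable {α β : Type*}

/-- The inverted text followed by the end marker. -/
def invText (T : List α) : List (Option α) := T.reverse.map some ++ [none]

/-- Leaves of the suffix tree of the terminated string `S`. -/
def IsLeaf (S X : List β) : Prop := X ≠ [] ∧ X <:+ S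

/-- Nodes of the suffix tree of the terminated string `S`: the root, the leaves and the
branching loci. -/
def IsNode (S X : List β) : Prop :=
  X = [] ∨ IsLeaf S X ∨ ∃ c d : β, c ≠ d ∧ X ++ [c] <:+: S ∧ X ++ [d] <:+: S

/-- `Y` is the parent node of the node `X`: its lowest proper ancestor. -/
def IsParent (S Y X : List β) : Prop :=
  IsNode S Y ∧ Y <+: X ∧ Y ≠ X ∧ ∀ Z, IsNode S Z → Z <+: X → Z ≠ X → Z <+: Y

/-- `B` is the highest node at or below the locus `X`; if `X` is not itself a node, it lies in the
interior of the edge that leads down to `B`. -/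
def IsLowerNode (S X B : List β) : Prop :=
  IsNode S B ∧ X <+: B ∧ ∀ Z, IsNode S Z → X <+: Z → B <+: Z

/-- The insertion point of the suffix `c :: S` in the suffix tree of `S`: the locus of the longest
prefix of `c :: S` that is a substring of `S`. -/
def IsInsertionPoint (c : β) (S X : List β) : Prop :=
  X <+: c :: S ∧ X <:+: S ∧ ∀ Z, Z <+: c :: S → Z <:+: S → Z.length ≤ X.length

end SuffixTree

/-! ### The word RAM

Structured programs for a machine with `w`-bit words, finitely many registers per program (all
register numbers are constants of the program) and a memory of words addressed by words. One and
the same program can be run for every word size. -/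

/-- Binary word operations. -/
inductive BinOp where
  | add | sub | mul | div | mod | and | or | xor | shl | shr | lt | eq

/-- The value of a word operation; comparisons are unsigned and return `1` or `0`. -/
def BinOp.eval {w : ℕ} : BinOp → BitVec w → BitVec w → BitVec w
  | .add, x, y => x + y
  | .sub, x, y => x - y
  | .mul, x, y => x * y
  | .div, x, y => x / y
  | .mod, x, y => x % y
  | .and, x, y => x &&& y
  | .or, x, y => x ||| y
  | .xor, x, y => x ^^^ y
  | .shl, x, y => x <<< y.toNat
  | .shr, x, y => x >>> y.toNat
  | .lt, x, y => if x.toNat < y.toNat then 1 else 0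
  | .eq, x, y => if x = y then 1 else 0

/-- Programs. -/
inductive Cmd where
  /-- `r_d := n` -/
  | const (d n : ℕ)
  /-- `r_d := r_a ∘ r_b` -/
  | op (o : BinOp) (d a b : ℕ)
  /-- `r_d := mem[r_a]` -/
  | load (d a : ℕ)
  /-- `mem[r_a] := r_b` -/
  | store (a b : ℕ)
  | seq (p q : Cmd)
  /-- if `r_r ≠ 0` then `p` else `q` -/
  | cond (r : ℕ) (p q : Cmd)
  /-- while `r_r ≠ 0` do `p` -/
  | loop (r : ℕ) (p : Cmd)

/-- Machine states. -/
structure State (w : ℕ) where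
  reg : ℕ → BitVec w
  mem : BitVec w → BitVec w

/-- Assign the value `v` to register `d`. -/
def State.setReg {w : ℕ} (s : State w) (d : ℕ) (v : BitVec w) : State w :=
  { s with reg := Function.update s.reg d v }

/-- Assign the value `v` to the memory cell `a`. -/
def State.setMem {w : ℕ} (s : State w) (a v : BitVec w) : State w :=
  { s with mem := Function.update s.mem a v }

/-- The state in which all registers and all memory cells are `0`. -/
def State.zero (w : ℕ) : State w := ⟨fun _ => 0, fun _ => 0⟩

/-- `Exec p s s' k m`: program `p`, started in state `s`, halts in state `s'` after `k` steps (one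
for each instruction and each test), and all memory cells that it reads or writes have
addresses `< m`. The number `m` is the least such number. -/
inductive Exec {w : ℕ} : Cmd → State w → State w → ℕ → ℕ → Prop where
  | const (d n : ℕ) (s : State w) :
      Exec (.const d n) s (s.setReg d (BitVec.ofNat w n)) 1 0
  | op (o : BinOp) (d a b : ℕ) (s : State w) :
      Exec (.op o d a b) s (s.setReg d (o.eval (s.reg a) (s.reg b))) 1 0
  | load (d a : ℕ) (s : State w) :
      Exec (.load d a) s (s.setReg d (s.mem (s.reg a))) 1 ((s.reg a).toNat + 1)
  | store (a b : ℕ) (s : State w) :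
      Exec (.store a b) s (s.setMem (s.reg a) (s.reg b)) 1 ((s.reg a).toNat + 1)
  | seq {p q : Cmd} {s s₁ s₂ : State w} {k₁ k₂ m₁ m₂ : ℕ} :
      Exec p s s₁ k₁ m₁ → Exec q s₁ s₂ k₂ m₂ → Exec (.seq p q) s s₂ (k₁ + k₂) (max m₁ m₂)
  | condTrue {r : ℕ} {p q : Cmd} {s s₁ : State w} {k m : ℕ} :
      s.reg r ≠ 0 → Exec p s s₁ k m → Exec (.cond r p q) s s₁ (k + 1) m
  | condFalse {r : ℕ} {p q : Cmd} {s s₁ : State w} {k m : ℕ} :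
      s.reg r = 0 → Exec q s s₁ k m → Exec (.cond r p q) s s₁ (k + 1) m
  | loopDone {r : ℕ} {p : Cmd} {s : State w} :
      s.reg r = 0 → Exec (.loop r p) s s 1 0
  | loopStep {r : ℕ} {p : Cmd} {s s₁ s₂ : State w} {k₁ k₂ m₁ m₂ : ℕ} :
      s.reg r ≠ 0 → Exec p s s₁ k₁ m₁ → Exec (.loop r p) s₁ s₂ k₂ m₂ →
      Exec (.loop r p) s s₂ (k₁ + k₂ + 1) (max m₁ m₂)

/-- Started in `s`, program `p` halts within `k` steps, uses only memory cells with addresses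
`< m`, and its final state satisfies `post`. -/
def Runs {w : ℕ} (p : Cmd) (s : State w) (k m : ℕ) (post : State w → Prop) : Prop :=
  ∃ s' k' m', Exec p s s' k' m' ∧ k' ≤ k ∧ m' ≤ m ∧ post s'

/-! ### Online suffix tree construction

An implementation of `SuffixUpdate` for the inverted text: when a letter `a` is appended to `T`,
the suffix tree of the inverted `T` is updated to the one of the inverted `T a`. -/

/-- The programs of an implementation. Arguments are passed and results returned in register `0`
(and register `1` for the second component of a result). -/
structure SUProgram where
  /-- start with the empty text; the argument is the alphabet size -/
  init : Cmd
  /-- read one letter -/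
  update : Cmd
  /-- pointer to a node `↦` pointer to its parent -/
  parent : Cmd
  /-- pointer to a node `↦` its string depth -/
  depth : Cmd
  /-- pointer to a node `↦` is it a leaf? -/
  isLeaf : Cmd

/-- On a machine with `w`-bit words, for texts of length at most `N` over the alphabet
`{0, …, σ - 1}`, the programs `P` maintain the suffix tree of the inverted text online. Whenever the
text read so far has length `n`, the operation that led to it and each navigation operation takes at
most `t n` steps in the worst case, and only the first `c * (n + 1)` words of memory are used.

`Rep s T addr` says that in the machine state `s` the suffix tree of the inverted text `T` is stored,
with the node `X` represented by the pointer `addr X`. An update returns the insertion point, as the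
pointer to the highest node of the old tree at or below it, together with its string depth. -/
def ImplementsSuffixUpdate (P : SUProgram) (w σ N : ℕ) (t : ℕ → ℕ) (c : ℕ) : Prop :=
  ∃ Rep : State w → List (BitVec w) → (List (Option (BitVec w)) → BitVec w) → Prop,
    (∀ s T addr, Rep s T addr → Set.InjOn addr {X | IsNode (invText T) X}) ∧
    Runs P.init ((State.zero w).setReg 0 (BitVec.ofNat w σ)) (t 0) c
      (fun s' => ∃ addr, Rep s' [] addr) ∧
    (∀ s T addr a, Rep s T addr → T.length < N → a.toNat < σ →
      Runs P.update (s.setReg 0 a) (t (T.length + 1)) (c * (T.length + 2))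
        (fun s' => ∃ addr', Rep s' (T ++ [a]) addr' ∧
          ∃ X B, IsInsertionPoint (some a) (invText T) X ∧ IsLowerNode (invText T) X B ∧
            s'.reg 0 = addr' B ∧ s'.reg 1 = BitVec.ofNat w X.length)) ∧
    (∀ s T addr X Y, Rep s T addr → IsNode (invText T) X → IsParent (invText T) Y X →
      Runs P.parent (s.setReg 0 (addr X)) (t T.length) (c * (T.length + 1))
        (fun s' => Rep s' T addr ∧ s'.reg 0 = addr Y)) ∧
    (∀ s T addr X, Rep s T addr → IsNode (invText T) X →
      Runs P.depth (s.setReg 0 (addr X)) (t T.length) (c * (T.length + 1))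
        (fun s' => Rep s' T addr ∧ s'.reg 0 = BitVec.ofNat w X.length)) ∧
    (∀ s T addr X, Rep s T addr → IsNode (invText T) X →
      Runs P.isLeaf (s.setReg 0 (addr X)) (t T.length) (c * (T.length + 1))
        (fun s' => Rep s' T addr ∧
          (IsLeaf (invText T) X → s'.reg 0 = 1) ∧ (¬ IsLeaf (invText T) X → s'.reg 0 = 0)))

/-! ### Online maintenance of the minimal unique substrings -/

/-- The programs of an implementation; arguments and results are passed in register `0`. -/
structure MUSProgram where
  /-- start with the empty text; the argument is the alphabet size -/
  init : Cmd
  /-- read one letter -/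
  update : Cmd
  /-- position `i ↦` the end of the minimal unique substring that starts at `i`, or `0` -/
  byStart : Cmd
  /-- position `i ↦` the start of the minimal unique substring that ends at `i`, or `0` -/
  byEnd : Cmd

/-- On a machine with `w`-bit words, for texts of length at most `N` over the alphabet
`{0, …, σ - 1}`, the programs `Q` maintain the set of minimal unique substrings of the text read so
far. Initialization takes at most `t 0` steps, reading the `n`-th letter takes at most `t n` steps in
the worst case, retrieving a minimal unique substring by one of its end points takes at most `d`
steps, and only the first `c * (n + 1)` words of memory are used as long as at most `n` letters have
been read. `Rep s T` says that the machine state `s` stores the data structure for `T`. -/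
def MaintainsMUS (Q : MUSProgram) (w σ N : ℕ) (t : ℕ → ℕ) (c d : ℕ) : Prop :=
  ∃ Rep : State w → List (BitVec w) → Prop,
    Runs Q.init ((State.zero w).setReg 0 (BitVec.ofNat w σ)) (t 0) c (fun s' => Rep s' []) ∧
    (∀ s T a, Rep s T → T.length < N → a.toNat < σ →
      Runs Q.update (s.setReg 0 a) (t (T.length + 1)) (c * (T.length + 2))
        (fun s' => Rep s' (T ++ [a]))) ∧
    (∀ s T i, Rep s T → 1 ≤ i → i ≤ T.length →
      Runs Q.byStart (s.setReg 0 (BitVec.ofNat w i)) d (c * (T.length + 1))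
        (fun s' => Rep s' T ∧
          (∀ e, (i, e) ∈ MUS T → s'.reg 0 = BitVec.ofNat w e) ∧
          ((∀ e, (i, e) ∉ MUS T) → s'.reg 0 = 0))) ∧
    (∀ s T i, Rep s T → 1 ≤ i → i ≤ T.length →
      Runs Q.byEnd (s.setReg 0 (BitVec.ofNat w i)) d (c * (T.length + 1))
        (fun s' => Rep s' T ∧
          (∀ b, (b, i) ∈ MUS T → s'.reg 0 = BitVec.ofNat w b) ∧
          ((∀ b, (b, i) ∉ MUS T) → s'.reg 0 = 0)))

end MUSOnline

open MUSOnline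

/-! Occurrences are recorded by their end positions: `Agree T l t e` compares the words of length
`l` that end at `t` and at `e`. Write j = |T|, and m, m' for the lengths of LSuf(T), LSuf(Ta).
Appending a letter changes nothing at the old end positions and adds the single end position j + 1.
So nothing repeating becomes unique, and a word of `T` that stops being unique is a suffix of `Ta`
that occurs exactly twice there (`UniqueAt.agree_last`). By `mem_MUS_iff` an interval is in `MUS`
iff its word is unique and the two words obtained by dropping its first or its last letter are
repeating.

Deletions (`MUS_diff_append`): a lost interval carries a double suffix of `Ta`, hence contains the
copy [s..q] of the shortest one, with the same end. That copy was already unique in `T`, so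
minimality of the lost interval forces equality.

Insertions (`MUS_append_diff`): a new interval ending at j + 1 extends LSuf(Ta) by one letter to the
left. Without its last letter it is the suffix of `T` of length m', which is repeating in `T` iff m'
≤ m; otherwise it has just become repeating, which means q = j. A new interval inside `T` was unique
but not minimal there, so one of its two maximal proper substrings has just become a double suffix.
If that is the one without the last letter, the interval is [s..q+1]; if it is the one without the
first letter, the interval is [q-m'..q]. Conversely, these two candidates can fail only when an old
minimal unique substring has the same end, respectively the same start.

Reading off: the leaves of the suffix tree of the inverted text correspond to the end positions, and
a locus lies above the leaf of `e` exactly when its word ends at `e` (`locus_prefix_iff`). Hence the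
insertion point X is LSuf(Ta) inverted. A double suffix exists iff LSuf(Ta) is nonempty and occurs
once in `T`, that is, exactly one old leaf, of depth q + 1, lies below X. Above X in the new tree
the set of leaves below a locus stays the same until the parent Y is reached, so the shortest double
suffix has length |Y| + 1.

Algorithm: cell x of `P` is moved to cell 3x, and the residues 1 and 2 modulo 3 hold two arrays
indexed by the starts and by the ends. In the new tree X is the parent of B
(`IsLowerNode.isParent`), so Y is reached from B by two parent queries. A letter thus costs a
bounded number of calls of `P` and of cell accesses. -/

namespace MUSOnline

/-! ### Occurrences by their end positions -/

section Words

variable {α : Type*}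

/-- The `l` letters of `T` that end at position `t` and those that end at position `e` agree. -/
def Agree (T : List α) (l t e : ℕ) : Prop :=
  l ≤ t ∧ l ≤ e ∧ t ≤ T.length ∧ e ≤ T.length ∧
    (T.take t).reverse.take l = (T.take e).reverse.take l

theorem Agree.refl {T : List α} {l t : ℕ} (h : l ≤ t) (h' : t ≤ T.length) : Agree T l t t :=
  ⟨h, h, h', h', rfl⟩

theorem Agree.symm {T : List α} {l t e : ℕ} (h : Agree T l t e) : Agree T l e t :=
  ⟨h.2.1, h.1, h.2.2.2.1, h.2.2.1, h.2.2.2.2.symm⟩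

theorem Agree.trans {T : List α} {l t e f : ℕ} (h : Agree T l t e) (h' : Agree T l e f) :
    Agree T l t f :=
  ⟨h.1, h'.2.1, h.2.2.1, h'.2.2.2.1, h.2.2.2.2.trans h'.2.2.2.2⟩

theorem Agree.mono {T : List α} {l l' t e : ℕ} (h : Agree T l t e) (hl : l' ≤ l) :
    Agree T l' t e := by
  refine ⟨hl.trans h.1, hl.trans h.2.1, h.2.2.1, h.2.2.2.1, ?_⟩
  have := congrArg (List.take l') h.2.2.2.2
  simpa [List.take_take, min_eq_left hl] using this

theorem agree_zero {T : List α} {t e : ℕ} (ht : t ≤ T.length) (he : e ≤ T.length) :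
    Agree T 0 t e :=
  ⟨Nat.zero_le _, Nat.zero_le _, ht, he, by simp⟩

theorem reverse_take_drop {T : List α} {t : ℕ} (k : ℕ) (ht : t ≤ T.length) :
    (T.take t).reverse.drop k = (T.take (t - k)).reverse := by
  rw [List.drop_reverse, List.length_take, min_eq_left ht, List.take_take,
    min_eq_left (Nat.sub_le _ _)]

/-- The last `k` letters are dropped from both words. If `k` exceeds `l`, truncated subtraction
leaves the empty word. -/
theorem Agree.shift {T : List α} {l t e : ℕ} (h : Agree T l t e) (k : ℕ) :
    Agree T (l - k) (t - k) (e - k) := by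
  obtain ⟨h1, h2, h3, h4, h5⟩ := h
  refine ⟨by omega, by omega, by omega, by omega, ?_⟩
  have := congrArg (List.drop k) h5
  rwa [List.drop_take, List.drop_take, reverse_take_drop k h3, reverse_take_drop k h4] at this

/-- The first |T| letters are unaffected by the append, so every new agreement involves the end
position |T| + 1. -/
theorem agree_append_iff {T : List α} {a : α} {l t e : ℕ} :
    Agree T l t e ↔ Agree (T ++ [a]) l t e ∧ t ≤ T.length ∧ e ≤ T.length := by
  have key : ∀ t, t ≤ T.length → (T ++ [a]).take t = T.take t := fun t ht =>
    List.take_append_of_le_length ht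
  constructor
  · rintro ⟨h1, h2, h3, h4, h5⟩
    exact ⟨⟨h1, h2, by simp; omega, by simp; omega, by rw [key t h3, key e h4]; exact h5⟩, h3, h4⟩
  · rintro ⟨⟨h1, h2, h3, h4, h5⟩, h6, h7⟩
    exact ⟨h1, h2, h6, h7, by rwa [key t h6, key e h7] at h5⟩

variable [DecidableEq α]

/-- Adding the length of `V` turns start positions into end positions; both range over 0, …, |T|, so
the empty word is counted correctly too. -/
theorem occ_eq_card_suffix (T V : List α) :
    occ T V = ((Finset.range (T.length + 1)).filter (fun e => V <:+ T.take e)).card := by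
  unfold occ
  refine Finset.card_bij (fun i _ => i + V.length) ?_ ?_ ?_
  · intro i hi
    simp only [Finset.mem_filter, Finset.mem_range] at hi ⊢
    obtain ⟨hi, R, hR⟩ := hi
    have hl := congrArg List.length hR
    simp only [List.length_append, List.length_drop] at hl
    refine ⟨by omega, T.take i, ?_⟩
    rw [List.take_add, ← hR, List.take_left]
  · intro i _ i' _ h
    simpa using h
  · intro e he
    simp only [Finset.mem_filter, Finset.mem_range] at he ⊢
    obtain ⟨he, R, hR⟩ := he
    have hl := congrArg List.length hR
    simp only [List.length_append, List.length_take] at hl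
    refine ⟨R.length, ⟨by omega, T.drop e, ?_⟩, by omega⟩
    conv_rhs => rw [← List.take_append_drop e T, ← hR]
    simp

/-- `V` is the word of length `l` that ends at position `t` of `T`. -/
def IsBlock (T : List α) (V : List α) (l t : ℕ) : Prop :=
  l ≤ t ∧ t ≤ T.length ∧ V.reverse = (T.take t).reverse.take l

omit [DecidableEq α] in
theorem isBlock_substr {T : List α} {s t : ℕ} (hs : 1 ≤ s) (hst : s ≤ t + 1)
    (ht : t ≤ T.length) : IsBlock T (substr T s t) (t + 1 - s) t := by
  refine ⟨by omega, ht, ?_⟩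
  rw [substr, List.reverse_drop, List.length_take, min_eq_left ht]
  congr 1
  omega

omit [DecidableEq α] in
theorem isBlock_suf {T : List α} {l : ℕ} (hl : l ≤ T.length) :
    IsBlock T (suf T l) l T.length := by
  refine ⟨hl, le_rfl, ?_⟩
  rw [suf, List.reverse_drop, List.take_length]
  congr 1
  omega

omit [DecidableEq α] in
theorem IsBlock.length {T V : List α} {l t : ℕ} (h : IsBlock T V l t) : V.length = l := by
  have := congrArg List.length h.2.2
  simp only [List.length_reverse, List.length_take] at this
  have := h.1
  have := h.2.1
  omega

omit [DecidableEq α] in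
theorem IsBlock.suffix_iff {T V : List α} {l t e : ℕ} (h : IsBlock T V l t) (he : e ≤ T.length) :
    V <:+ T.take e ↔ Agree T l t e := by
  rw [← List.reverse_prefix, List.prefix_iff_eq_take, List.length_reverse, h.length, h.2.2]
  refine ⟨fun hh => ⟨h.1, ?_, h.2.1, he, hh⟩, fun hh => hh.2.2.2.2⟩
  have := congrArg List.length hh
  simp only [List.length_reverse, List.length_take] at this
  have := h.1
  have := h.2.1
  omega

omit [DecidableEq α] in
theorem IsBlock.eq_iff {T V W : List α} {l t e : ℕ} (h : IsBlock T V l t) (h' : IsBlock T W l e) :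
    V = W ↔ Agree T l t e := by
  rw [← List.reverse_inj, h.2.2, h'.2.2]
  exact ⟨fun hh => ⟨h.1, h'.1, h.2.1, h'.2.1, hh⟩, fun hh => hh.2.2.2.2⟩

theorem IsBlock.mem_ends {T V : List α} {l t e : ℕ} (h : IsBlock T V l t) :
    e ∈ (Finset.range (T.length + 1)).filter (fun e => V <:+ T.take e) ↔ Agree T l t e := by
  rw [Finset.mem_filter, Finset.mem_range]
  constructor
  · rintro ⟨h1, h2⟩
    exact (h.suffix_iff (by omega)).1 h2
  · intro hh
    have := hh.2.2.2.1
    exact ⟨by omega, (h.suffix_iff this).2 hh⟩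

/-- The word of length `l` that ends at position `t` occurs nowhere else in `T`. -/
def UniqueAt (T : List α) (l t : ℕ) : Prop := ∀ e, Agree T l t e → e = t

theorem IsBlock.isUnique_iff {T V : List α} {l t : ℕ} (h : IsBlock T V l t) :
    IsUnique T V ↔ UniqueAt T l t := by
  rw [IsUnique, occ_eq_card_suffix, Finset.card_eq_one]
  constructor
  · rintro ⟨x, hx⟩ e he
    have h1 := h.mem_ends.2 he
    have h2 := h.mem_ends.2 (Agree.refl h.1 h.2.1)
    rw [hx, Finset.mem_singleton] at h1 h2
    omega
  · intro hu
    refine ⟨t, Finset.ext fun e => ?_⟩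
    rw [h.mem_ends, Finset.mem_singleton]
    refine ⟨hu e, ?_⟩
    rintro rfl
    exact Agree.refl h.1 h.2.1

theorem IsBlock.isRepeating_iff {T V : List α} {l t : ℕ} (h : IsBlock T V l t) :
    IsRepeating T V ↔ ∃ e, Agree T l t e ∧ e ≠ t := by
  rw [IsRepeating, occ_eq_card_suffix, Nat.succ_le_iff, Finset.one_lt_card]
  constructor
  · rintro ⟨x, hx, y, hy, hxy⟩
    rw [h.mem_ends] at hx hy
    by_cases hxt : x = t
    · exact ⟨y, hy, by omega⟩
    · exact ⟨x, hx, hxt⟩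
  · rintro ⟨e, he, het⟩
    exact ⟨e, h.mem_ends.2 he, t, h.mem_ends.2 (Agree.refl h.1 h.2.1), het⟩

theorem IsBlock.occ_eq_two_iff {T V : List α} {l t : ℕ} (h : IsBlock T V l t) :
    occ T V = 2 ↔ ∃ q, q ≠ t ∧ Agree T l t q ∧ ∀ e, Agree T l t e → e = q ∨ e = t := by
  rw [occ_eq_card_suffix, Finset.card_eq_two]
  have ht := h.mem_ends.2 (Agree.refl h.1 h.2.1)
  constructor
  · rintro ⟨x, y, hxy, hx⟩
    rw [hx, Finset.mem_insert, Finset.mem_singleton] at ht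
    have key : ∀ e, Agree T l t e ↔ e = x ∨ e = y := fun e => by
      rw [← h.mem_ends, hx, Finset.mem_insert, Finset.mem_singleton]
    rcases ht with ht | ht
    · exact ⟨y, by omega, (key y).2 (by simp), fun e he => by have := (key e).1 he; omega⟩
    · exact ⟨x, by omega, (key x).2 (by simp), fun e he => by have := (key e).1 he; omega⟩
  · rintro ⟨q, hq, hA, hall⟩
    refine ⟨q, t, hq, Finset.ext fun e => ?_⟩
    rw [h.mem_ends, Finset.mem_insert, Finset.mem_singleton]
    refine ⟨hall e, ?_⟩
    rintro (rfl | rfl)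
    · exact hA
    · exact Agree.refl h.1 h.2.1

theorem occ_anti {T R W : List α} (h : R <:+: W) : occ T W ≤ occ T R := by
  obtain ⟨u, v, rfl⟩ := h
  refine Finset.card_le_card_of_injOn (fun i => i + u.length) ?_ ?_
  · intro i hi
    simp only [Finset.coe_filter, Finset.mem_range, Set.mem_ofPred_eq] at hi ⊢
    obtain ⟨hi, x, hx⟩ := hi
    have hl := congrArg List.length hx
    simp only [List.length_append, List.length_drop] at hl
    refine ⟨by omega, v ++ x, ?_⟩
    rw [← List.drop_drop, ← hx]
    simp
  · intro i _ i' _ h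
    simpa using h

omit [DecidableEq α] in
theorem not_uniqueAt_iff {T : List α} {l t : ℕ} :
    ¬ UniqueAt T l t ↔ ∃ e, Agree T l t e ∧ e ≠ t := by
  simp [UniqueAt]

-- With `occ_anti`, this reduces the condition on all proper substrings in `MUS` to the two maximal
-- ones.
omit [DecidableEq α] in
theorem infix_tail_or_dropLast {R W : List α} (h : R <:+: W) (hne : R ≠ W) :
    R <:+: W.tail ∨ R <:+: W.dropLast := by
  obtain ⟨u, v, rfl⟩ := h
  rcases u with _ | ⟨x, u⟩
  · right
    rcases List.eq_nil_or_concat v with rfl | ⟨v, y, rfl⟩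
    · simp at hne
    · refine ⟨[], v, ?_⟩
      simp [← List.append_assoc]
  · left
    exact ⟨u, v, by simp⟩

theorem mem_MUS_iff {T : List α} {s t : ℕ} :
    (s, t) ∈ MUS T ↔ 1 ≤ s ∧ s ≤ t ∧ t ≤ T.length ∧ UniqueAt T (t + 1 - s) t ∧
      ¬ UniqueAt T (t - s) t ∧ ¬ UniqueAt T (t - s) (t - 1) := by
  simp only [MUS, Set.mem_ofPred_eq]
  refine and_congr_right fun hs => and_congr_right fun hst => and_congr_right fun ht => ?_
  have hb := isBlock_substr hs (by omega : s ≤ t + 1) ht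
  rw [hb.isUnique_iff]
  refine and_congr_right fun _ => ?_
  -- Both maximal proper substrings have length `t - s`; they end at `t` and at `t - 1`.
  have h1 : IsBlock T (substr T (s + 1) t) (t - s) t := by
    have := isBlock_substr (T := T) (by omega : 1 ≤ s + 1) (by omega : s + 1 ≤ t + 1) ht
    rwa [show t + 1 - (s + 1) = t - s by omega] at this
  have h2 : IsBlock T (substr T s (t - 1)) (t - s) (t - 1) := by
    have := isBlock_substr (T := T) hs (by omega : s ≤ t - 1 + 1) (by omega : t - 1 ≤ T.length)
    rwa [show t - 1 + 1 - s = t - s by omega] at this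
  have e1 : (substr T s t).tail = substr T (s + 1) t := by
    rw [substr, substr, List.tail_drop]
    congr 1
    omega
  have e2 : (substr T s t).dropLast = substr T s (t - 1) := by
    rw [substr, substr, List.dropLast_eq_take, List.length_drop, List.length_take, min_eq_left ht,
      List.drop_take, List.drop_take, List.take_take]
    congr 1
    omega
  rw [not_uniqueAt_iff, not_uniqueAt_iff, ← h1.isRepeating_iff, ← h2.isRepeating_iff]
  constructor
  · intro h
    refine ⟨h _ ?_ ?_, h _ ?_ ?_⟩
    · rw [← e1]
      exact (List.tail_suffix _).isInfix
    · intro he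
      have := congrArg List.length he
      rw [h1.length, hb.length] at this
      omega
    · rw [← e2]
      exact (List.dropLast_prefix _).isInfix
    · intro he
      have := congrArg List.length he
      rw [h2.length, hb.length] at this
      omega
  · rintro ⟨g1, g2⟩ R hR hne
    rcases infix_tail_or_dropLast hR hne with h | h
    · rw [e1] at h
      exact g1.trans (occ_anti h)
    · rw [e2] at h
      exact g2.trans (occ_anti h)

/-- The copy of the shortest double suffix in terms of end positions. -/
theorem isSSufCopy_iff {T : List α} {s q : ℕ} :
    IsSSufCopy T s q ↔ 1 ≤ s ∧ s ≤ q ∧ q < T.length ∧ Agree T (q + 1 - s) T.length q ∧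
      (∀ e, Agree T (q + 1 - s) T.length e → e = q ∨ e = T.length) ∧
      ∀ l, 1 ≤ l → l < q + 1 - s → ∃ e, e ≠ q ∧ e ≠ T.length ∧ Agree T l T.length e := by
  rw [IsSSufCopy]
  refine and_congr_right fun hs => and_congr_right fun hsq => and_congr_right fun hq => ?_
  have hb := isBlock_substr hs (by omega : s ≤ q + 1) hq.le
  have hc := isBlock_suf (T := T) (l := q + 1 - s) (by omega)
  rw [hb.eq_iff hc, IsSSuf, hc.occ_eq_two_iff]
  constructor
  · rintro ⟨⟨-, -, ⟨q', hq', hA', hall⟩, hmin⟩, hA⟩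
    have hqq : q = q' := by
      have := hall q hA.symm
      omega
    subst hqq
    refine ⟨hA', hall, fun l hl hl' => ?_⟩
    by_contra hcon
    push Not at hcon
    refine hmin l hl hl' ((isBlock_suf (by omega)).occ_eq_two_iff.2 ⟨q, hq', hA'.mono hl'.le, ?_⟩)
    intro e he
    by_contra hne
    push Not at hne
    exact hcon e hne.1 hne.2 he
  · rintro ⟨hA, hall, hmin⟩
    refine ⟨⟨by omega, by omega, ⟨q, by omega, hA, hall⟩, fun l hl hl' h2 => ?_⟩, hA.symm⟩
    obtain ⟨q', hq', hA', hall'⟩ := (isBlock_suf (by omega)).occ_eq_two_iff.1 h2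
    obtain ⟨e, he, he', hAe⟩ := hmin l hl hl'
    have h3 := hall' e hAe
    have h4 := hall' q (hA.mono hl'.le)
    omega

theorem exists_isSSufCopy_of_isSSuf {T : List α} {l : ℕ} (h : IsSSuf T l) :
    ∃ s q, IsSSufCopy T s q ∧ l = q + 1 - s := by
  obtain ⟨q, hq, hA, -⟩ := (isBlock_suf h.2.1).occ_eq_two_iff.1 h.2.2.1
  have h1 := h.1
  have := hA.2.1
  have := hA.2.2.2.1
  have hl : q + 1 - (q + 1 - l) = l := by omega
  refine ⟨q + 1 - l, q, ⟨by omega, by omega, by omega, by rwa [hl], ?_⟩, hl.symm⟩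
  have hb := isBlock_substr (T := T) (by omega : 1 ≤ q + 1 - l) (by omega) hA.2.2.2.1
  rw [hl] at hb ⊢
  exact (hb.eq_iff (isBlock_suf h.2.1)).2 hA.symm

theorem exists_isSSuf_iff {T : List α} : (∃ l, IsSSuf T l) ↔ ∃ s q, IsSSufCopy T s q := by
  constructor
  · rintro ⟨l, h⟩
    obtain ⟨s, q, h, -⟩ := exists_isSSufCopy_of_isSSuf h
    exact ⟨s, q, h⟩
  · rintro ⟨s, q, h⟩
    exact ⟨_, h.2.2.2.1⟩

theorem IsSSuf.unique {T : List α} {l l' : ℕ} (h : IsSSuf T l) (h' : IsSSuf T l') : l = l' := by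
  rcases lt_trichotomy l l' with hl | hl | hl
  · exact absurd h.2.2.1 (h'.2.2.2 l h.1 hl)
  · exact hl
  · exact absurd h'.2.2.1 (h.2.2.2 l' h'.1 hl)

/-- The lengths agree by minimality, and a double suffix has only one occurrence that is not the
suffix itself. -/
theorem IsSSufCopy.unique {T : List α} {s q s' q' : ℕ} (h : IsSSufCopy T s q)
    (h' : IsSSufCopy T s' q') : s = s' ∧ q = q' := by
  have hl := h.2.2.2.1.unique h'.2.2.2.1
  obtain ⟨h1, h2, h3, h4, h5, -⟩ := isSSufCopy_iff.1 h
  obtain ⟨g1, g2, g3, g4, -⟩ := isSSufCopy_iff.1 h'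
  rw [← hl] at g4
  have := h5 q' g4
  omega

/-- Being a repeating suffix is inherited by shorter suffixes. The disjunct `l = 0` is needed for
the empty text, where `lsuf` takes its default value. -/
theorem le_lsuf_iff {T : List α} {l : ℕ} :
    l ≤ lsuf T ↔ l = 0 ∨ ∃ e, e < T.length ∧ Agree T l T.length e := by
  have key : ∀ l, l ≤ T.length →
      (2 ≤ occ T (suf T l) ↔ ∃ e, e < T.length ∧ Agree T l T.length e) := fun l hl => by
    rw [show (2 ≤ occ T (suf T l)) = IsRepeating T (suf T l) from rfl,
      (isBlock_suf hl).isRepeating_iff]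
    constructor
    · rintro ⟨e, he, hne⟩
      exact ⟨e, lt_of_le_of_ne he.2.2.2.1 hne, he⟩
    · rintro ⟨e, he, hA⟩
      exact ⟨e, hA, he.ne⟩
  constructor
  · intro h
    rcases Nat.eq_zero_or_pos (lsuf T) with h0 | h0
    · left
      omega
    · right
      have h1 : lsuf T ≤ T.length := Nat.findGreatest_le _
      obtain ⟨e, he, hA⟩ := (key _ h1).1 (Nat.findGreatest_of_ne_zero (P := fun l => 2 ≤ occ T (suf T l))
        (m := lsuf T) rfl h0.ne')
      exact ⟨e, he, hA.mono h⟩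
  · rintro (rfl | ⟨e, he, hA⟩)
    · exact Nat.zero_le _
    · exact Nat.le_findGreatest hA.1 ((key l hA.1).2 ⟨e, he, hA⟩)

end Words

/-! ### Changes of the set of minimal unique substrings -/

section Updates

variable {α : Type*} [DecidableEq α] {T : List α} {a : α}

omit [DecidableEq α] in
theorem uniqueAt_iff_append {l t : ℕ} (ht : t ≤ T.length) :
    UniqueAt T l t ↔ ∀ e, e ≤ T.length → Agree (T ++ [a]) l t e → e = t := by
  constructor
  · exact fun h e he hA => h e (agree_append_iff.2 ⟨hA, ht, he⟩)
  · exact fun h e hA => h e hA.2.2.2.1 (agree_append_iff.1 hA).1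

omit [DecidableEq α] in
theorem UniqueAt.mono {l l' t : ℕ} (h : UniqueAt T l t) (hl : l ≤ l') : UniqueAt T l' t :=
  fun e hA => h e (hA.mono hl)

omit [DecidableEq α] in
theorem UniqueAt.of_append {l t : ℕ} (h : UniqueAt (T ++ [a]) l t) : UniqueAt T l t :=
  fun e hA => h e (agree_append_iff.1 hA).1

omit [DecidableEq α] in
/-- A word that is unique in `T` but not in `T a` is a suffix of `T a` that occurs exactly twice. -/
theorem UniqueAt.agree_last {l t : ℕ} (ht : t ≤ T.length) (h : UniqueAt T l t)
    (h' : ¬ UniqueAt (T ++ [a]) l t) :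
    Agree (T ++ [a]) l (T.length + 1) t ∧
      ∀ e, Agree (T ++ [a]) l (T.length + 1) e → e = t ∨ e = T.length + 1 := by
  rw [uniqueAt_iff_append (a := a) ht] at h
  obtain ⟨e, he, hne⟩ := not_uniqueAt_iff.1 h'
  have h1 := he.2.2.2.1
  simp only [List.length_append, List.length_singleton] at h1
  have h2 : e = T.length + 1 := by
    by_contra hcon
    exact hne (h e (by omega) he)
  subst h2
  refine ⟨he.symm, fun f hf => ?_⟩
  have h3 := hf.2.2.2.1
  simp only [List.length_append, List.length_singleton] at h3
  by_cases hf' : f = T.length + 1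
  · exact Or.inr hf'
  · exact Or.inl (h f (by omega) (he.trans hf))

omit [DecidableEq α] in
theorem not_uniqueAt_zero (hT : T ≠ []) {t : ℕ} (ht : t ≤ T.length) : ¬ UniqueAt T 0 t := by
  have hl := List.length_pos_iff.2 hT
  rw [not_uniqueAt_iff]
  by_cases h0 : t = 0
  · exact ⟨1, agree_zero ht hl, by omega⟩
  · exact ⟨0, agree_zero ht (Nat.zero_le _), by omega⟩

theorem isSSufCopy_append_iff {s q : ℕ} :
    IsSSufCopy (T ++ [a]) s q ↔ 1 ≤ s ∧ s ≤ q ∧ q ≤ T.length ∧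
      Agree (T ++ [a]) (q + 1 - s) (T.length + 1) q ∧
      (∀ e, Agree (T ++ [a]) (q + 1 - s) (T.length + 1) e → e = q ∨ e = T.length + 1) ∧
      ∀ l, 1 ≤ l → l < q + 1 - s →
        ∃ e, e ≠ q ∧ e ≤ T.length ∧ Agree (T ++ [a]) l (T.length + 1) e := by
  rw [isSSufCopy_iff, List.length_append, List.length_singleton, Nat.lt_succ_iff]
  refine and_congr_right fun _ => and_congr_right fun _ => and_congr_right fun _ =>
    and_congr_right fun _ => and_congr_right fun _ => forall_congr' fun l =>
    forall_congr' fun _ => forall_congr' fun _ => exists_congr fun e => and_congr_right fun _ => ?_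
  constructor
  · rintro ⟨h, hA⟩
    have := hA.2.2.2.1
    simp only [List.length_append, List.length_singleton] at this
    exact ⟨by omega, hA⟩
  · rintro ⟨h, hA⟩
    exact ⟨by omega, hA⟩

/-- A double suffix of `T a` contains the shortest one. -/
theorem exists_isSSufCopy {l q : ℕ} (hl : 1 ≤ l) (hq : q ≤ T.length)
    (hA : Agree (T ++ [a]) l (T.length + 1) q)
    (h : ∀ e, Agree (T ++ [a]) l (T.length + 1) e → e = q ∨ e = T.length + 1) :
    ∃ s, IsSSufCopy (T ++ [a]) s q ∧ q + 1 - s ≤ l := by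
  classical
  -- The occurrence at `q` need not be part of the minimized property: it is inherited from length
  -- `l` by every shorter suffix.
  let p : ℕ → Prop := fun k => 1 ≤ k ∧
    ∀ e, Agree (T ++ [a]) k (T.length + 1) e → e = q ∨ e = T.length + 1
  have hp : ∃ k, p k := ⟨l, hl, h⟩
  have hk := Nat.find_spec hp
  have hkl : Nat.find hp ≤ l := Nat.find_min' hp ⟨hl, h⟩
  have hlq := hA.2.1
  have hmin := fun k => @Nat.find_min _ _ hp k
  generalize Nat.find hp = k at hk hkl hmin
  have e1 : q + 1 - (q + 1 - k) = k := by omega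
  refine ⟨q + 1 - k, isSSufCopy_append_iff.2 ⟨by omega, ?_, hq, ?_, ?_, ?_⟩, by omega⟩
  · have := hk.1
    omega
  · rw [e1]
    exact hA.mono hkl
  · rw [e1]
    exact hk.2
  · intro l' hl' hlk
    rw [e1] at hlk
    by_contra hcon
    push Not at hcon
    refine hmin l' hlk ⟨hl', fun e he => ?_⟩
    have := he.2.2.2.1
    simp only [List.length_append, List.length_singleton] at this
    by_contra hne
    push Not at hne
    exact hcon e hne.1 (by omega) he

theorem IsSSufCopy.uniqueAt {s q : ℕ} (h : IsSSufCopy (T ++ [a]) s q) :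
    UniqueAt T (q + 1 - s) q := by
  obtain ⟨-, -, h3, h4, h5, -⟩ := isSSufCopy_append_iff.1 h
  rw [uniqueAt_iff_append (a := a) h3]
  intro e he hA
  have := h5 e (h4.trans hA)
  omega

theorem IsSSufCopy.not_uniqueAt {s q l : ℕ} (h : IsSSufCopy (T ++ [a]) s q) (hl : l < q + 1 - s) :
    ¬ UniqueAt T l q := by
  obtain ⟨h1, h2, h3, h4, h5, h6⟩ := isSSufCopy_append_iff.1 h
  rcases Nat.eq_zero_or_pos l with rfl | hl0
  · refine not_uniqueAt_zero ?_ h3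
    rintro rfl
    simp at h3
    omega
  · obtain ⟨e, he, he', hA⟩ := h6 l hl0 hl
    rw [not_uniqueAt_iff]
    exact ⟨e, agree_append_iff.2 ⟨(h4.mono hl.le).symm.trans hA, h3, he'⟩, he⟩

/-- Without its first letter the copy is a shorter suffix of `Ta`, which by minimality has a third
occurrence. Without its last letter it also occurs at the end of `T`, because the double suffix ends
with the appended letter. -/
theorem IsSSufCopy.mem_MUS {s q : ℕ} (h : IsSSufCopy (T ++ [a]) s q) : (s, q) ∈ MUS T := by
  obtain ⟨h1, h2, h3, h4, h5, h6⟩ := isSSufCopy_append_iff.1 h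
  rw [mem_MUS_iff]
  refine ⟨h1, h2, h3, h.uniqueAt, h.not_uniqueAt (by omega), ?_⟩
  rw [not_uniqueAt_iff]
  refine ⟨T.length, ?_, by omega⟩
  have := h4.symm.shift 1
  rw [show q + 1 - s - 1 = q - s by omega, Nat.add_sub_cancel] at this
  exact agree_append_iff.2 ⟨this, by omega, le_rfl⟩

theorem MUS_diff_append (T : List α) (a : α) :
    MUS T \ MUS (T ++ [a]) = {p | IsSSufCopy (T ++ [a]) p.1 p.2} := by
  ext ⟨s, t⟩
  simp only [Set.mem_sdiff, Set.mem_ofPred_eq]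
  constructor
  · rintro ⟨h, h'⟩
    obtain ⟨h1, h2, h3, h4, h5, h6⟩ := mem_MUS_iff.1 h
    have hu : ¬ UniqueAt (T ++ [a]) (t + 1 - s) t := by
      intro hu
      exact h' (mem_MUS_iff.2 ⟨h1, h2, by simp; omega, hu, fun g => h5 g.of_append,
        fun g => h6 g.of_append⟩)
    obtain ⟨hA, hall⟩ := h4.agree_last h3 hu
    obtain ⟨s', hs', hle⟩ := exists_isSSufCopy (by omega) h3 hA hall
    have hs1 := (isSSufCopy_append_iff.1 hs').1
    have hs2 := (isSSufCopy_append_iff.1 hs').2.1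
    -- Otherwise the shortest double suffix starts after `s`, and its uniqueness in `T` passes to
    -- the word without the first letter.
    have : s = s' := by
      by_contra hne
      exact h5 (hs'.uniqueAt.mono (by omega))
    rwa [this]
  · intro h
    refine ⟨h.mem_MUS, fun h' => ?_⟩
    obtain ⟨-, -, h3, h4, -⟩ := isSSufCopy_append_iff.1 h
    have := (mem_MUS_iff.1 h').2.2.2.1 _ h4.symm
    omega

/-- Minimal unique substrings are never nested: the shorter one would lie in a repeating proper
substring of the longer one. -/
theorem MUS_start_unique {s t t' : ℕ} (h : (s, t) ∈ MUS T) (h' : (s, t') ∈ MUS T) : t = t' := by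
  have key : ∀ t t', (s, t) ∈ MUS T → (s, t') ∈ MUS T → ¬ t < t' := by
    intro t t' h h' hlt
    obtain ⟨h1, h2, h3, h4, -, -⟩ := mem_MUS_iff.1 h
    obtain ⟨g1, g2, g3, -, -, g6⟩ := mem_MUS_iff.1 h'
    obtain ⟨e, he, hne⟩ := not_uniqueAt_iff.1 g6
    have := h4 (e - (t' - 1 - t)) (by
      have := he.shift (t' - 1 - t)
      rwa [show t' - s - (t' - 1 - t) = t + 1 - s by omega,
        show t' - 1 - (t' - 1 - t) = t by omega] at this)
    have := he.2.1
    omega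
  have := key _ _ h h'
  have := key _ _ h' h
  omega

theorem MUS_end_unique {s s' t : ℕ} (h : (s, t) ∈ MUS T) (h' : (s', t) ∈ MUS T) : s = s' := by
  have key : ∀ s s', (s, t) ∈ MUS T → (s', t) ∈ MUS T → ¬ s < s' := by
    intro s s' h h' hlt
    obtain ⟨h1, h2, h3, -, h5, -⟩ := mem_MUS_iff.1 h
    obtain ⟨g1, g2, g3, g4, -, -⟩ := mem_MUS_iff.1 h'
    exact h5 (g4.mono (by omega))
  have := key _ _ h h'
  have := key _ _ h' h
  omega

/-- If a word ending at `t` is unique but becomes repeating by dropping its last letter, then a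
minimal unique substring ends at `t`. -/
theorem exists_MUS_end {l t : ℕ} (hT : T ≠ []) (ht : t ≤ T.length) (hl : l ≤ t)
    (h : UniqueAt T l t) (h' : ¬ UniqueAt T (l - 1) (t - 1)) : ∃ x, (x, t) ∈ MUS T := by
  classical
  have hex : ∃ k, UniqueAt T k t := ⟨l, h⟩
  have hk := Nat.find_spec hex
  have hkl : Nat.find hex ≤ l := Nat.find_min' hex h
  have hmin := fun k => @Nat.find_min _ _ hex k
  generalize Nat.find hex = k at hk hkl hmin
  have hk0 : k ≠ 0 := by
    rintro rfl
    exact not_uniqueAt_zero hT ht hk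
  refine ⟨t + 1 - k, mem_MUS_iff.2 ⟨by omega, by omega, ht, ?_, hmin _ (by omega), fun hu => ?_⟩⟩
  · rwa [show t + 1 - (t + 1 - k) = k by omega]
  · exact h' (hu.mono (by omega))

omit [DecidableEq α] in
theorem UniqueAt.extend {l t k : ℕ} (h : UniqueAt T l t) : UniqueAt T (l + k) (t + k) := by
  intro e hA
  have h1 := hA.2.1
  have h2 := hA.shift k
  simp only [Nat.add_sub_cancel] at h2
  have := h _ h2
  omega

/-- If a word is unique but becomes repeating by dropping its first letter, then a
minimal unique substring starts where it starts. -/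
theorem exists_MUS_start {s t : ℕ} (hT : T ≠ []) (ht : t ≤ T.length) (hs : 1 ≤ s)
    (h : UniqueAt T (t + 1 - s) t) (h' : ¬ UniqueAt T (t - s) t) :
    ∃ x, (s, x) ∈ MUS T := by
  classical
  have hex : ∃ x, s ≤ x + 1 ∧ UniqueAt T (x + 1 - s) x := by
    by_cases hst : s ≤ t + 1
    · exact ⟨t, hst, h⟩
    · rw [show t - s = t + 1 - s by omega] at h'
      exact absurd h h'
  have hst : s ≤ t + 1 := by
    by_contra hst
    rw [show t - s = t + 1 - s by omega] at h'
    exact h' h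
  have hk := Nat.find_spec hex
  have hkl : Nat.find hex ≤ t := Nat.find_min' hex ⟨hst, h⟩
  have hmin := fun k => @Nat.find_min _ _ hex k
  generalize Nat.find hex = x at hk hkl hmin
  have hsx : s ≤ x := by
    by_contra hcon
    rw [show x + 1 - s = 0 by omega] at hk
    exact not_uniqueAt_zero hT (by omega) hk.2
  refine ⟨x, mem_MUS_iff.2 ⟨hs, hsx, by omega, hk.2, fun hu => ?_, fun hu => ?_⟩⟩
  · have := hu.extend (k := t - x)
    rw [show x - s + (t - x) = t - s by omega, show x + (t - x) = t by omega] at this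
    exact h' this
  · refine hmin (x - 1) (by omega) ⟨by omega, ?_⟩
    rwa [show x - 1 + 1 - s = x - s by omega]

theorem lsuf_append_agree (T : List α) (a : α) :
    ∃ e, e ≤ T.length ∧ Agree (T ++ [a]) (lsuf (T ++ [a])) (T.length + 1) e := by
  have h := (le_lsuf_iff (T := T ++ [a])).1 le_rfl
  simp only [List.length_append, List.length_singleton] at h
  rcases h with h | ⟨e, he, hA⟩
  · exact ⟨0, Nat.zero_le _, by rw [h]; exact agree_zero (by simp) (Nat.zero_le _)⟩
  · exact ⟨e, by omega, hA⟩

theorem agree_le_lsuf_append {l e : ℕ} (he : e ≤ T.length)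
    (hA : Agree (T ++ [a]) l (T.length + 1) e) : l ≤ lsuf (T ++ [a]) := by
  rw [le_lsuf_iff]
  exact Or.inr ⟨e, by simp; omega, by simpa using hA⟩

theorem lsuf_append_le : lsuf (T ++ [a]) ≤ T.length := by
  obtain ⟨e, he, hA⟩ := lsuf_append_agree T a
  exact hA.2.1.trans he

theorem IsSSufCopy.le_lsuf {s q : ℕ} (h : IsSSufCopy (T ++ [a]) s q) :
    q + 1 - s ≤ lsuf (T ++ [a]) := by
  obtain ⟨-, -, h3, h4, -⟩ := isSSufCopy_append_iff.1 h
  exact agree_le_lsuf_append h3 h4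

theorem IsSSufCopy.agree_lsuf {s q : ℕ} (h : IsSSufCopy (T ++ [a]) s q) :
    Agree (T ++ [a]) (lsuf (T ++ [a])) (T.length + 1) q := by
  obtain ⟨e, he, hA⟩ := lsuf_append_agree T a
  have := (isSSufCopy_append_iff.1 h).2.2.2.2.1 e (hA.mono h.le_lsuf)
  have : e = q := by omega
  rwa [this] at hA

theorem uniqueAt_suffix_append {l : ℕ} (hl : lsuf (T ++ [a]) < l) :
    UniqueAt (T ++ [a]) l (T.length + 1) := by
  intro e hA
  by_contra hne
  have := hA.2.2.2.1
  simp only [List.length_append, List.length_singleton] at this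
  have := agree_le_lsuf_append (by omega) hA
  omega

theorem mem_MUS_append_last (h : lsuf (T ++ [a]) ≤ lsuf T) :
    (T.length + 1 - lsuf (T ++ [a]), T.length + 1) ∈ MUS (T ++ [a]) := by
  obtain ⟨e, he, hA⟩ := lsuf_append_agree T a
  have hle := lsuf_append_le (T := T) (a := a)
  refine mem_MUS_iff.2 ⟨by omega, by omega, by simp, uniqueAt_suffix_append (by omega), ?_, ?_⟩
  · rw [show T.length + 1 - (T.length + 1 - lsuf (T ++ [a])) = lsuf (T ++ [a]) by omega,
      not_uniqueAt_iff]
    exact ⟨e, hA, by omega⟩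
  · rw [show T.length + 1 - (T.length + 1 - lsuf (T ++ [a])) = lsuf (T ++ [a]) by omega,
      Nat.add_sub_cancel, not_uniqueAt_iff]
    rcases le_lsuf_iff.1 h with h0 | ⟨f, hf, hB⟩
    · rw [h0]
      exact ⟨T.length + 1, agree_zero (by simp) (by simp), by omega⟩
    · exact ⟨f, (agree_append_iff.1 hB).1, by omega⟩

theorem IsSSufCopy.ne_nil {s q : ℕ} (h : IsSSufCopy (T ++ [a]) s q) : T ≠ [] := by
  obtain ⟨h1, h2, h3, -⟩ := isSSufCopy_append_iff.1 h
  rintro rfl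
  simp at h3
  omega

/-- The second occurrence of the double suffix is at the very end of `Ta` and cannot be extended to
the right, so [s..q+1] is unique. If [s+1..q+1] were unique as well, then, as [s+1..q] is repeating
in `T`, either `T` would have a minimal unique substring ending at q + 1, or q = j and the suffix
would recur at `q`. -/
theorem IsSSufCopy.mem_MUS_extend {s q : ℕ} (h : IsSSufCopy (T ++ [a]) s q)
    (hq : ∀ x, (x, q + 1) ∉ MUS T) : (s, q + 1) ∈ MUS (T ++ [a]) := by
  obtain ⟨h1, h2, h3, h4, h5, h6⟩ := isSSufCopy_append_iff.1 h
  refine mem_MUS_iff.2 ⟨h1, by omega, by simp; omega, ?_, fun hu => ?_, ?_⟩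
  · intro e hA
    have h7 := hA.shift 1
    have := hA.2.1
    have := hA.2.2.2.1
    simp only [List.length_append, List.length_singleton] at this
    rw [Nat.add_sub_cancel, show q + 1 + 1 - s - 1 = q + 1 - s by omega] at h7
    have := h5 _ (h4.trans h7)
    omega
  · by_cases hqj : q = T.length
    · have := hu q (by rw [show q + 1 = T.length + 1 by omega] at *; exact h4)
      omega
    · obtain ⟨x, hx⟩ := exists_MUS_end h.ne_nil (by omega : q + 1 ≤ T.length) (by omega)
        (hu.of_append) (by
          rw [Nat.add_sub_cancel]
          exact h.not_uniqueAt (by omega))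
      exact hq x hx
  · rw [Nat.add_sub_cancel, not_uniqueAt_iff]
    exact ⟨_, h4.symm, by omega⟩

/-- LSuf(Ta) contains the shortest double suffix, so its earlier occurrence ends at `q` too. One
more letter to the left makes it unique, being longer than any repeating suffix. Its part before the
last letter recurs at the end of `T`; this is the repeating word used for `exists_MUS_start`. -/
theorem IsSSufCopy.mem_MUS_lsuf {s q : ℕ} (h : IsSSufCopy (T ++ [a]) s q)
    (hm : 1 + lsuf (T ++ [a]) ≤ q) (hq : ∀ x, (q - lsuf (T ++ [a]), x) ∉ MUS T) :
    (q - lsuf (T ++ [a]), q) ∈ MUS (T ++ [a]) := by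
  obtain ⟨h1, h2, h3, h4, h5, h6⟩ := isSSufCopy_append_iff.1 h
  have hl := h.le_lsuf
  have hA := h.agree_lsuf
  have hu : UniqueAt (T ++ [a]) (lsuf (T ++ [a]) + 1) q := by
    intro e he
    rcases h5 e (h4.trans (he.mono (by omega))) with h7 | rfl
    · exact h7
    · exact absurd (agree_le_lsuf_append h3 he.symm) (by omega)
  refine mem_MUS_iff.2 ⟨by omega, by omega, by simp; omega, ?_, ?_, fun hv => ?_⟩
  · rwa [show q + 1 - (q - lsuf (T ++ [a])) = lsuf (T ++ [a]) + 1 by omega]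
  · rw [show q - (q - lsuf (T ++ [a])) = lsuf (T ++ [a]) by omega, not_uniqueAt_iff]
    exact ⟨_, hA.symm, by omega⟩
  · obtain ⟨x, hx⟩ := exists_MUS_start (T := T) (s := q - lsuf (T ++ [a])) (t := q - 1) h.ne_nil
      (by omega) (by omega) (by
        have := hv.of_append
        rwa [show q - 1 + 1 = q by omega]) (by
        rw [not_uniqueAt_iff]
        refine ⟨T.length, (agree_append_iff (a := a)).2 ⟨?_, by omega, le_rfl⟩, by omega⟩
        have := hA.symm.shift 1
        rwa [Nat.add_sub_cancel, show lsuf (T ++ [a]) - 1 = q - 1 - (q - lsuf (T ++ [a])) by omega]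
          at this)
    exact hq x hx

theorem MUS_append_diff (T : List α) (a : α) :
    MUS (T ++ [a]) \ MUS T =
      {p | lsuf (T ++ [a]) ≤ lsuf T ∧ p = (T.length + 1 - lsuf (T ++ [a]), T.length + 1)} ∪
      {p | ∃ s q, IsSSufCopy (T ++ [a]) s q ∧ (∀ x, (x, q + 1) ∉ MUS T) ∧ p = (s, q + 1)} ∪
      {p | ∃ s q, IsSSufCopy (T ++ [a]) s q ∧ 1 + lsuf (T ++ [a]) ≤ q ∧
        (∀ x, (q - lsuf (T ++ [a]), x) ∉ MUS T) ∧ p = (q - lsuf (T ++ [a]), q)} := by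
  ext ⟨s, t⟩
  simp only [Set.mem_sdiff, Set.mem_union, Set.mem_ofPred_eq, Prod.mk.injEq]
  constructor
  swap
  · rintro ((⟨h, rfl, rfl⟩ | ⟨s, q, h, hq, rfl, rfl⟩) | ⟨s, q, h, hm, hq, rfl, rfl⟩)
    · exact ⟨mem_MUS_append_last h, fun h' => by have := (mem_MUS_iff.1 h').2.2.1; omega⟩
    · exact ⟨h.mem_MUS_extend hq, hq _⟩
    · exact ⟨h.mem_MUS_lsuf hm hq, hq _⟩
  rintro ⟨h, h'⟩
  obtain ⟨h1, h2, h3, h4, h5, h6⟩ := mem_MUS_iff.1 h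
  simp only [List.length_append, List.length_singleton] at h3
  obtain ⟨e', he', hA'⟩ := lsuf_append_agree T a
  by_cases htj : t = T.length + 1
  · subst htj
    obtain ⟨e, he, hne⟩ := not_uniqueAt_iff.1 h5
    have := he.2.2.2.1
    simp only [List.length_append, List.length_singleton] at this
    have hle := agree_le_lsuf_append (by omega) he
    have hge : lsuf (T ++ [a]) < T.length + 1 + 1 - s := by
      by_contra hcon
      have := h4 e' (hA'.mono (by omega))
      omega
    by_cases hm : lsuf (T ++ [a]) ≤ lsuf T
    · exact Or.inl (Or.inl ⟨hm, by omega, rfl⟩)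
    have hm0 : 1 ≤ lsuf (T ++ [a]) := by omega
    have hlen : T.length + 1 - s = lsuf (T ++ [a]) := by omega
    rw [hlen, Nat.add_sub_cancel] at h6
    have hu : UniqueAt T (lsuf (T ++ [a])) T.length := by
      intro f hf
      by_contra hne'
      exact hm (le_lsuf_iff.2 (Or.inr ⟨f, lt_of_le_of_ne hf.2.2.2.1 hne', hf⟩))
    obtain ⟨hA, hall⟩ := hu.agree_last le_rfl h6
    obtain ⟨s', hs', hle'⟩ := exists_isSSufCopy hm0 le_rfl hA hall
    have hs1 := (isSSufCopy_append_iff.1 hs').1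
    have hs2 := (isSSufCopy_append_iff.1 hs').2.1
    -- The suffix of length m' also ends at j. If the shortest double suffix were shorter than m',
    -- shifting this agreement by one would give it a third occurrence, ending at j - 1.
    have hs3 : s = s' := by
      by_contra hne'
      have hB := hA.shift 1
      rw [Nat.add_sub_cancel] at hB
      have := (isSSufCopy_append_iff.1 hs').2.2.2.2.1 (T.length - 1)
        ((hA.mono hle').trans (hB.mono (by omega)))
      omega
    exact Or.inl (Or.inr ⟨s', T.length, hs',
      fun x hx => by have := (mem_MUS_iff.1 hx).2.2.1; omega, hs3, rfl⟩)
  have htj' : t ≤ T.length := by omega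
  have hT : T ≠ [] := by
    rintro rfl
    simp at htj'
    omega
  have h4' := h4.of_append
  -- First case: the word without its last letter was unique in `T`, so it has just become a double
  -- suffix and q = t - 1.
  by_cases hu : UniqueAt T (t - s) (t - 1)
  · obtain ⟨hA, hall⟩ := hu.agree_last (by omega) h6
    have hts : 1 ≤ t - s := by
      by_contra hcon
      rw [show t - s = 0 by omega] at hu
      exact not_uniqueAt_zero hT (by omega) hu
    obtain ⟨s', hs', hle⟩ := exists_isSSufCopy hts (by omega) hA hall
    obtain ⟨g1, g2, g3, g4, g5, -⟩ := isSSufCopy_append_iff.1 hs'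
    -- If the shortest double suffix started after `s`, the repeating word [s+1..t] would end with
    -- it followed by one letter. A second occurrence would then end at q + 1 = t or beyond `Ta`.
    have hss : s = s' := by
      by_contra hne
      obtain ⟨e, he, hne'⟩ := not_uniqueAt_iff.1 h5
      have := he.2.1
      have := he.2.2.2.1
      simp only [List.length_append, List.length_singleton] at this
      have := g5 (e - 1) (g4.trans ((he.shift 1).mono (by omega)))
      omega
    subst hss
    refine Or.inl (Or.inr ⟨s, t - 1, hs', ?_, rfl, by omega⟩)
    rw [show t - 1 + 1 = t by omega]
    intro x hx
    obtain ⟨k1, k2, k3, k4, k5, k6⟩ := mem_MUS_iff.1 hx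
    have hsx : s < x := by
      by_contra hcon
      exact k6 (hu.mono (by omega))
    -- An old minimal unique substring ending at `t` would also have become a double suffix, forcing
    -- q = t.
    obtain ⟨hB, hall'⟩ := k4.agree_last k3 fun hc => h5 (hc.mono (by omega))
    obtain ⟨s', hs'', -⟩ := exists_isSSufCopy (by omega) k3 hB hall'
    have := (hs'.unique hs'').2
    omega
  · have hv : UniqueAt T (t - s) t := by
      by_contra hv
      exact h' (mem_MUS_iff.2 ⟨h1, h2, htj', h4', hv, hu⟩)
    obtain ⟨hA, hall⟩ := hv.agree_last htj' h5
    have hts : 1 ≤ t - s := by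
      by_contra hcon
      rw [show t - s = 0 by omega] at hv
      exact not_uniqueAt_zero hT (by omega) hv
    obtain ⟨s', hs', hle⟩ := exists_isSSufCopy hts htj' hA hall
    have hm : t - s ≤ lsuf (T ++ [a]) := agree_le_lsuf_append htj' hA
    -- Here q = t, and LSuf(Ta) also occurs at `q`; if it were longer, [s..t] would recur at the end
    -- of `Ta`.
    have hm' : lsuf (T ++ [a]) < t + 1 - s := by
      by_contra hcon
      have := h4 _ (hs'.agree_lsuf.mono (by omega)).symm
      omega
    have hst : t - lsuf (T ++ [a]) = s := by omega
    refine Or.inr ⟨s', t, hs', by omega, ?_, hst.symm, rfl⟩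
    rw [hst]
    intro x hx
    obtain ⟨k1, k2, k3, k4, k5, k6⟩ := mem_MUS_iff.1 hx
    -- For `x < t` the word [s..t-1] would be unique in `T`; for `x > t` the interval [s..x] would
    -- properly contain the unique [s..t].
    rcases lt_trichotomy x t with hxt | hxt | hxt
    · have := k4.extend (k := t - 1 - x)
      rw [show x + 1 - s + (t - 1 - x) = t - s by omega,
        show x + (t - 1 - x) = t - 1 by omega] at this
      exact hu this
    · rw [hxt] at hx
      exact h' hx
    · have := h4'.extend (k := x - 1 - t)
      rw [show t + 1 - s + (x - 1 - t) = x - s by omega,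
        show t + (x - 1 - t) = x - 1 by omega] at this
      exact k6 this

theorem encard_MUS_diff_append_le (T : List α) (a : α) :
    (MUS T \ MUS (T ++ [a])).encard ≤ 1 := by
  rw [MUS_diff_append, Set.encard_le_one_iff]
  rintro ⟨s, q⟩ ⟨s', q'⟩ h h'
  exact Prod.ext (h.unique h').1 (h.unique h').2

theorem encard_MUS_diff_append_eq_one_iff (T : List α) (a : α) :
    (MUS T \ MUS (T ++ [a])).encard = 1 ↔ ∃ l, IsSSuf (T ++ [a]) l := by
  rw [exists_isSSuf_iff]
  constructor
  · intro h
    obtain ⟨⟨s, q⟩, hx⟩ := Set.encard_eq_one.1 h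
    have : (s, q) ∈ MUS T \ MUS (T ++ [a]) := hx ▸ Set.mem_singleton _
    rw [MUS_diff_append] at this
    exact ⟨s, q, this⟩
  · rintro ⟨s, q, h⟩
    refine le_antisymm (encard_MUS_diff_append_le T a) (Set.one_le_encard_iff_nonempty.2 ⟨(s, q), ?_⟩)
    rw [MUS_diff_append]
    exact h

theorem encard_MUS_append_diff_le (T : List α) (a : α) :
    (MUS (T ++ [a]) \ MUS T).encard ≤ 3 := by
  rw [MUS_append_diff]
  refine (Set.encard_union_le _ _).trans ?_
  rw [show (3 : ℕ∞) = 1 + 1 + 1 by norm_num]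
  refine add_le_add ((Set.encard_union_le _ _).trans (add_le_add ?_ ?_)) ?_
  · rw [Set.encard_le_one_iff]
    rintro _ _ ⟨-, rfl⟩ ⟨-, rfl⟩
    rfl
  · rw [Set.encard_le_one_iff]
    rintro _ _ ⟨s, q, h, -, rfl⟩ ⟨s', q', h', -, rfl⟩
    rw [(h.unique h').1, (h.unique h').2]
  · rw [Set.encard_le_one_iff]
    rintro _ _ ⟨s, q, h, -, -, rfl⟩ ⟨s', q', h', -, -, rfl⟩
    rw [(h.unique h').2]

end Updates

/-! ### Suffix trees -/

section Trees

variable {β : Type*}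

theorem exists_longest_common_prefix (B Z : List β) :
    ∃ P, P <+: B ∧ P <+: Z ∧ (∀ Q, Q <+: B → Q <+: Z → Q <+: P) ∧
      (P = B ∨ P = Z ∨ ∃ c d, c ≠ d ∧ P ++ [c] <+: B ∧ P ++ [d] <+: Z) := by
  induction B generalizing Z with
  | nil => exact ⟨[], by simp, by simp, fun Q h _ => h, Or.inl rfl⟩
  | cons b B ih =>
    rcases Z with _ | ⟨z, Z⟩
    · exact ⟨[], by simp, by simp, fun Q _ h => h, Or.inr (Or.inl rfl)⟩
    · by_cases hbz : b = z
      · subst hbz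
        obtain ⟨P, h1, h2, h3, h4⟩ := ih Z
        refine ⟨b :: P, by simpa using h1, by simpa using h2, ?_, ?_⟩
        · rintro (_ | ⟨x, Q⟩) hQ hQ'
          · simp
          · rw [List.cons_prefix_cons] at hQ hQ' ⊢
            exact ⟨hQ.1, h3 Q hQ.2 hQ'.2⟩
        · rcases h4 with rfl | rfl | ⟨c, d, hcd, h5, h6⟩
          · exact Or.inl rfl
          · exact Or.inr (Or.inl rfl)
          · exact Or.inr (Or.inr ⟨c, d, hcd, by simpa using h5, by simpa using h6⟩)
      · refine ⟨[], by simp, by simp, ?_, Or.inr (Or.inr ⟨b, z, hbz, by simp, by simp⟩)⟩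
        rintro (_ | ⟨x, Q⟩) hQ hQ'
        · simp
        · rw [List.cons_prefix_cons] at hQ hQ'
          exact absurd (hQ.1.symm.trans hQ'.1) hbz

theorem append_singleton_prefix_inj {Y Z : List β} {c d : β} (h : Y ++ [c] <+: Z)
    (h' : Y ++ [d] <+: Z) : c = d := by
  have := (List.prefix_of_prefix_length_le h h' (by simp)).eq_of_length (by simp)
  simpa using this

theorem exists_append_singleton_prefix {Y Z : List β} (h : Y <+: Z) (hne : Y ≠ Z) :
    ∃ c, Y ++ [c] <+: Z := by
  obtain ⟨_ | ⟨c, r⟩, rfl⟩ := h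
  · simp at hne
  · exact ⟨c, r, by simp⟩

theorem IsNode.isInfix {S X : List β} (h : IsNode S X) : X <:+: S := by
  rcases h with rfl | h | ⟨c, d, -, h, -⟩
  · exact List.nil_infix
  · exact h.2.isInfix
  · exact (List.prefix_append X [c]).isInfix.trans h

/-- Take a shortest node below `X`. The place where the path to another such node leaves the path to
`B` is itself a node below `X`, and being no longer than `B` it is `B`. -/
theorem exists_isLowerNode {S X : List β} (hX : X <:+: S) :
    ∃ B, IsLowerNode S X B := by
  classical
  have hex : ∃ k B, IsNode S B ∧ X <+: B ∧ B.length = k := by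
    obtain ⟨t, h1, h2⟩ := List.infix_iff_prefix_suffix.1 hX
    by_cases ht : t = []
    · exact ⟨_, [], Or.inl rfl, ht ▸ h1, rfl⟩
    · exact ⟨_, t, Or.inr (Or.inl ⟨ht, h2⟩), h1, rfl⟩
  have hk := Nat.find_spec hex
  have hmin := fun k => @Nat.find_min _ _ hex k
  generalize Nat.find hex = k at hk hmin
  obtain ⟨B, hB, hXB, rfl⟩ := hk
  refine ⟨B, hB, hXB, fun Z hZ hXZ => ?_⟩
  obtain ⟨P, h1, h2, h3, h4⟩ := exists_longest_common_prefix B Z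
  have hP : IsNode S P → P = B := fun hn => by
    by_contra hne
    refine hmin P.length ?_ ⟨P, hn, h3 X hXB hXZ, rfl⟩
    exact lt_of_le_of_ne h1.length_le fun he => hne (h1.eq_of_length he)
  rcases h4 with rfl | rfl | ⟨c, d, hcd, h5, h6⟩
  · exact h2
  · exact hP hZ ▸ List.prefix_rfl
  · rw [← hP (Or.inr (Or.inr ⟨c, d, hcd, h5.isInfix.trans hB.isInfix, h6.isInfix.trans hZ.isInfix⟩))]
    exact h2

theorem exists_isParent {S X : List β} (hX : X ≠ []) : ∃ Y, IsParent S Y X := by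
  classical
  have h0 : ∃ Y, IsNode S Y ∧ Y <+: X ∧ Y ≠ X ∧ Y.length = 0 :=
    ⟨[], Or.inl rfl, by simp, hX.symm, rfl⟩
  have hk := Nat.findGreatest_spec (P := fun k => ∃ Y, IsNode S Y ∧ Y <+: X ∧ Y ≠ X ∧ Y.length = k)
    (Nat.zero_le X.length) h0
  have hle := fun k => Nat.le_findGreatest
    (P := fun k => ∃ Y, IsNode S Y ∧ Y <+: X ∧ Y ≠ X ∧ Y.length = k) (m := k) (n := X.length)
  generalize Nat.findGreatest (fun k => ∃ Y, IsNode S Y ∧ Y <+: X ∧ Y ≠ X ∧ Y.length = k) X.length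
    = k at hk hle
  obtain ⟨Y, h1, h2, h3, rfl⟩ := hk
  exact ⟨Y, h1, h2, h3, fun Z g1 g2 g3 =>
    List.prefix_of_prefix_length_le g2 h2 (hle _ g2.length_le ⟨Z, g1, g2, g3, rfl⟩)⟩

theorem IsInsertionPoint.unique {c : β} {S X X' : List β} (h : IsInsertionPoint c S X)
    (h' : IsInsertionPoint c S X') : X = X' :=
  (List.prefix_of_prefix_length_le h.1 h'.1 (h'.2.2 _ h.1 h.2.1)).eq_of_length
    (le_antisymm (h'.2.2 _ h.1 h.2.1) (h.2.2 _ h'.1 h'.2.1))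

theorem IsNode.cons {c : β} {S X : List β} (h : IsNode S X) : IsNode (c :: S) X := by
  have hs : S <:+ c :: S := List.suffix_cons c S
  rcases h with rfl | h | ⟨x, y, hxy, h, h'⟩
  · exact Or.inl rfl
  · exact Or.inr (Or.inl ⟨h.1, h.2.trans hs⟩)
  · exact Or.inr (Or.inr ⟨x, y, hxy, h.trans hs.isInfix, h'.trans hs.isInfix⟩)

/-- The only additional leaf is `c :: S` itself, which is excluded by its length. -/
theorem isLeaf_cons_iff {c : β} {S X : List β} (h : X.length ≤ S.length) :
    IsLeaf (c :: S) X ↔ IsLeaf S X := by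
  refine and_congr_right fun _ => ?_
  rw [List.suffix_cons_iff]
  refine or_iff_right ?_
  rintro rfl
  simp at h

/-- After the insertion of the suffix `c :: S`, the insertion point `X` inside an edge is the
parent of the lower end `B` of that edge. -/
theorem IsLowerNode.isParent {c : β} {S X B : List β} (hX : IsInsertionPoint c S X)
    (hn : ¬ IsNode S X) (hn' : IsNode (c :: S) X) (hB : IsLowerNode S X B) :
    IsParent (c :: S) X B := by
  refine ⟨hn', hB.2.1, fun h => hn (h ▸ hB.1), fun Z hZ hZB hne => ?_⟩
  rcases List.prefix_or_prefix_of_prefix hZB hB.2.1 with h | h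
  · exact h
  have key : ¬ IsNode S Z := fun hS =>
    hne (hZB.eq_of_length_le (hB.2.2 Z hS h).length_le)
  have hZS : Z <:+: S := hZB.isInfix.trans hB.1.isInfix
  -- A continuation that is new in `c :: S` starts at its first position, so `Z` is both a prefix of
  -- the new suffix and an old locus. Maximality of the insertion point bounds its length.
  have hlow : ∀ x, Z ++ [x] <:+: c :: S → ¬ Z ++ [x] <:+: S → Z <+: X := fun x h1 h2 => by
    have h3 : Z <+: c :: S := by
      rcases List.infix_cons_iff.1 h1 with h3 | h3
      · exact (List.prefix_append _ _).trans h3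
      · exact absurd h3 h2
    rw [h.eq_of_length_le (hX.2.2 Z h3 hZS)]
  rcases hZ with rfl | hZ | ⟨x, y, hxy, h1, h2⟩
  · simp
  · exact absurd (Or.inr (Or.inl ((isLeaf_cons_iff hZS.length_le).1 hZ))) key
  · by_cases g1 : Z ++ [x] <:+: S
    · by_cases g2 : Z ++ [y] <:+: S
      · exact absurd (Or.inr (Or.inr ⟨x, y, hxy, g1, g2⟩)) key
      · exact hlow y h2 g2
    · exact hlow x h1 g1

end Trees

/-! ### Loci of the inverted text -/

section Loci

variable {α : Type*}

/-- The inverse of the word of length `l` that ends at position `t`, as a locus. -/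
def locus (T : List α) (l t : ℕ) : List (Option α) := ((T.take t).reverse.take l).map some

theorem none_not_mem_locus (T : List α) (l t : ℕ) : none ∉ locus T l t := by
  intro h
  obtain ⟨x, -, hx⟩ := List.mem_map.1 h
  exact Option.some_ne_none x hx

theorem none_mem_invText (T : List α) : none ∈ invText T := by
  simp [invText]

theorem length_invText (T : List α) : (invText T).length = T.length + 1 := by
  simp [invText]

theorem length_locus {T : List α} {l t : ℕ} (hl : l ≤ t) (ht : t ≤ T.length) :
    (locus T l t).length = l := by
  simp [locus]
  omega

theorem invText_append (T : List α) (a : α) : invText (T ++ [a]) = some a :: invText T := by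
  simp [invText]

theorem map_some_append_none_prefix {u v : List α}
    (h : u.map some ++ [none] <+: v.map some ++ [none]) : u = v := by
  induction u generalizing v with
  | nil =>
    rcases v with _ | ⟨y, v⟩
    · rfl
    · simp at h
  | cons x u ih =>
    rcases v with _ | ⟨y, v⟩
    · simp at h
    · simp only [List.map_cons, List.cons_append, List.cons_prefix_cons, Option.some.injEq] at h
      rw [h.1, ih h.2]

theorem invText_take_prefix {T : List α} {e e' : ℕ} (he : e ≤ T.length) (he' : e' ≤ T.length)
    (h : invText (T.take e) <+: invText (T.take e')) : e = e' := by
  have := congrArg List.length (map_some_append_none_prefix h)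
  simp only [List.length_reverse, List.length_take] at this
  omega

/-- Leaves correspond to the end positions 0, …, |T|: a nonempty suffix of the inverted text is the
inverse of a prefix of `T` with its marker. Position `e` has depth `e + 1`. -/
theorem isLeaf_invText_iff {T : List α} {X : List (Option α)} :
    IsLeaf (invText T) X ↔ ∃ e, e ≤ T.length ∧ X = invText (T.take e) := by
  have key : ∀ e, e ≤ T.length → (invText T).drop (T.length - e) = invText (T.take e) := by
    intro e he
    rw [invText, List.drop_append_of_le_length (by simp), ← List.map_drop, List.drop_reverse,
      invText]
    congr 4
    omega
  constructor
  · rintro ⟨h1, h2⟩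
    have h3 := h2.length_le
    have h4 := List.length_pos_iff.2 h1
    rw [length_invText] at h3
    refine ⟨X.length - 1, by omega, ?_⟩
    rw [← key _ (by omega), List.suffix_iff_eq_drop.1 h2, length_invText]
    congr 1
    simp [length_invText]
    omega
  · rintro ⟨e, he, rfl⟩
    exact ⟨List.ne_nil_of_mem (none_mem_invText _), key e he ▸ List.drop_suffix _ _⟩

theorem infix_invText_iff {T : List α} {X : List (Option α)} :
    X <:+: invText T ↔ ∃ e, e ≤ T.length ∧ X <+: invText (T.take e) := by
  rw [List.infix_iff_prefix_suffix]
  constructor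
  · rintro ⟨t, h1, h2⟩
    by_cases ht : t = []
    · subst ht
      rw [List.prefix_nil] at h1
      exact ⟨0, Nat.zero_le _, by simp [h1]⟩
    · obtain ⟨e, he, rfl⟩ := isLeaf_invText_iff.1 ⟨ht, h2⟩
      exact ⟨e, he, h1⟩
  · rintro ⟨e, he, h⟩
    exact ⟨_, h, (isLeaf_invText_iff.2 ⟨e, he, rfl⟩).2⟩

theorem prefix_invText_cases {T : List α} {X : List (Option α)} {e : ℕ} (he : e ≤ T.length)
    (h : X <+: invText (T.take e)) :
    X = invText (T.take e) ∨ X.length ≤ e ∧ X = locus T X.length e := by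
  have hl := h.length_le
  rw [length_invText, List.length_take, min_eq_left he] at hl
  rcases Nat.lt_or_ge e X.length with h1 | h1
  · left
    refine h.eq_of_length ?_
    rw [length_invText, List.length_take, min_eq_left he]
    omega
  · right
    refine ⟨h1, ?_⟩
    conv_lhs => rw [List.prefix_iff_eq_take.1 h]
    rw [invText, List.take_append_of_le_length (by simp; omega), locus, List.map_take]

/-- The bridge between the two halves of the proof: ancestry of leaves in the suffix tree is
agreement of end positions. -/
theorem locus_prefix_iff {T : List α} {l t e : ℕ} (hl : l ≤ t) (ht : t ≤ T.length)
    (he : e ≤ T.length) : locus T l t <+: invText (T.take e) ↔ Agree T l t e := by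
  have hlen := length_locus hl ht
  constructor
  · intro h
    rcases prefix_invText_cases he h with h1 | ⟨h1, h2⟩
    · exact absurd (h1 ▸ none_mem_invText _) (none_not_mem_locus T l t)
    · rw [hlen] at h1 h2
      exact ⟨hl, h1, ht, he, List.map_injective_iff.2 (Option.some_injective _) h2⟩
  · intro h
    rw [locus, h.2.2.2.2, List.map_take, invText]
    exact (List.take_prefix _ _).trans (List.prefix_append _ _)

theorem reverse_suf_map {T : List α} {l : ℕ} (hl : l ≤ T.length) :
    (suf T l).reverse.map some = locus T l T.length := by
  rw [(isBlock_suf hl).2.2, locus]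

end Loci

/-! ### The insertion point and the two suffixes -/

section InsertionPoint

variable {α : Type*} [DecidableEq α] {T : List α} {a : α}

omit [DecidableEq α] in
theorem take_append_eq {e : ℕ} (he : e ≤ T.length) : (T ++ [a]).take e = T.take e :=
  List.take_append_of_le_length he

omit [DecidableEq α] in
theorem take_append_all : (T ++ [a]).take (T.length + 1) = T ++ [a] :=
  List.take_of_length_le (by simp)

omit [DecidableEq α] in
theorem locus_append_prefix_iff {l e : ℕ} (hl : l ≤ T.length + 1) (he : e ≤ T.length) :
    locus (T ++ [a]) l (T.length + 1) <+: invText (T.take e) ↔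
      Agree (T ++ [a]) l (T.length + 1) e := by
  rw [← take_append_eq (a := a) he, locus_prefix_iff hl (by simp) (by simp; omega)]

omit [DecidableEq α] in
theorem locus_append_prefix {l : ℕ} (hl : l ≤ T.length + 1) :
    locus (T ++ [a]) l (T.length + 1) <+: invText (T ++ [a]) := by
  have := (locus_prefix_iff (T := T ++ [a]) hl (by simp) (by simp)).2 (Agree.refl hl (by simp))
  rwa [take_append_all] at this

/-- The longest repeating suffix of `T a`, as a locus. -/
def lsufLocus (T : List α) (a : α) : List (Option α) :=
  locus (T ++ [a]) (lsuf (T ++ [a])) (T.length + 1)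

theorem length_lsufLocus : (lsufLocus T a).length = lsuf (T ++ [a]) :=
  length_locus ((lsuf_append_le (T := T) (a := a)).trans (Nat.le_succ _)) (by simp)

theorem lsufLocus_prefix_iff {e : ℕ} (he : e ≤ T.length) :
    lsufLocus T a <+: invText (T.take e) ↔
      Agree (T ++ [a]) (lsuf (T ++ [a])) (T.length + 1) e :=
  locus_append_prefix_iff ((lsuf_append_le (T := T) (a := a)).trans (Nat.le_succ _)) he

theorem lsufLocus_prefix : lsufLocus T a <+: invText (T ++ [a]) :=
  locus_append_prefix ((lsuf_append_le (T := T) (a := a)).trans (Nat.le_succ _))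

theorem lsufLocus_eq :
    lsufLocus T a = (suf (T ++ [a]) (lsuf (T ++ [a]))).reverse.map some := by
  have := lsuf_append_le (T := T) (a := a)
  rw [reverse_suf_map (by simp; omega), lsufLocus, List.length_append, List.length_singleton]

theorem isInsertionPoint_lsufLocus (T : List α) (a : α) :
    IsInsertionPoint (some a) (invText T) (lsufLocus T a) := by
  rw [IsInsertionPoint, ← invText_append]
  refine ⟨lsufLocus_prefix, ?_, ?_⟩
  · obtain ⟨e, he, hA⟩ := lsuf_append_agree T a
    exact infix_invText_iff.2 ⟨e, he, (lsufLocus_prefix_iff he).2 hA⟩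
  · intro Z h1 h2
    obtain ⟨e, he, hZ⟩ := infix_invText_iff.1 h2
    rw [length_lsufLocus]
    rw [← take_append_all] at h1
    -- A prefix that reaches the end marker is the whole new suffix, which is too long for the old
    -- tree.
    rcases prefix_invText_cases (by simp) h1 with h | ⟨h3, h4⟩
    · have := hZ.length_le
      rw [h, take_append_all, length_invText, length_invText] at this
      simp only [List.length_append, List.length_singleton, List.length_take] at this
      omega
    · rw [h4, locus_append_prefix_iff h3 he] at hZ
      exact agree_le_lsuf_append he hZ

/-- A branching `X` means two occurrences of LSuf(Ta) in `T`, hence at least three in `Ta` of any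
double suffix inside it. The root would make LSuf(Ta) empty, and leaves carry the end marker. -/
theorem not_exists_isSSuf_of_isNode (h : IsNode (invText T) (lsufLocus T a)) :
    ¬ ∃ l, IsSSuf (T ++ [a]) l := by
  rw [exists_isSSuf_iff]
  rintro ⟨s, q, hs⟩
  obtain ⟨h1, h2, h3, h4, h5, -⟩ := isSSufCopy_append_iff.1 hs
  have hle := hs.le_lsuf
  rcases h with h | h | ⟨c, d, hcd, hc, hd⟩
  · have := congrArg List.length h
    rw [length_lsufLocus, List.length_nil] at this
    omega
  · obtain ⟨e, -, he⟩ := isLeaf_invText_iff.1 h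
    exact none_not_mem_locus _ _ _ (he ▸ none_mem_invText _ : none ∈ lsufLocus T a)
  · obtain ⟨e, he, hc⟩ := infix_invText_iff.1 hc
    obtain ⟨e', he', hd⟩ := infix_invText_iff.1 hd
    have g1 := h5 e (((lsufLocus_prefix_iff he).1 ((List.prefix_append _ _).trans hc)).mono hle)
    have g2 := h5 e' (((lsufLocus_prefix_iff he').1 ((List.prefix_append _ _).trans hd)).mono hle)
    have hee : e = e' := by omega
    subst hee
    exact hcd (append_singleton_prefix_inj hc hd)

/-- The old tree continues `X` by some letter and the new suffix by another one; maximality of `X`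
makes them differ. -/
theorem isNode_append_lsufLocus (T : List α) (a : α) :
    IsNode (invText (T ++ [a])) (lsufLocus T a) := by
  have hX := isInsertionPoint_lsufLocus T a
  obtain ⟨e, he, h⟩ := infix_invText_iff.1 hX.2.1
  have hne : ∀ U : List α, lsufLocus T a ≠ invText U := fun U hU =>
    none_not_mem_locus _ _ _ (hU ▸ none_mem_invText _ : none ∈ lsufLocus T a)
  obtain ⟨c, hc⟩ := exists_append_singleton_prefix h (hne _)
  obtain ⟨d, hd⟩ := exists_append_singleton_prefix lsufLocus_prefix (hne _)
  have hc' := infix_invText_iff.2 ⟨e, he, hc⟩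
  refine Or.inr (Or.inr ⟨c, d, ?_, ?_, hd.isInfix⟩)
  · rintro rfl
    rw [invText_append] at hd
    have := hX.2.2 _ hd hc'
    simp at this
  · rw [invText_append]
    exact hc'.trans (List.suffix_cons _ _).isInfix

theorem lsuf_append_pos (h : ¬ IsNode (invText T) (lsufLocus T a)) :
    1 ≤ lsuf (T ++ [a]) := by
  by_contra hcon
  refine h (Or.inl (List.length_eq_zero_iff.1 ?_))
  rw [length_lsufLocus]
  omega

/-- `B` is a leaf iff a single old leaf lies below `X`, that is, iff LSuf(Ta) occurs once in `T`.
The end marker keeps one leaf from being a proper prefix of another. -/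
theorem exists_isSSuf_iff_isLeaf {B : List (Option α)}
    (hn : ¬ IsNode (invText T) (lsufLocus T a))
    (hB : IsLowerNode (invText T) (lsufLocus T a) B) :
    (∃ l, IsSSuf (T ++ [a]) l) ↔ IsLeaf (invText T) B := by
  rw [exists_isSSuf_iff]
  have hpos := lsuf_append_pos hn
  constructor
  · rintro ⟨s, q, h⟩
    obtain ⟨h1, h2, h3, h4, h5, -⟩ := isSSufCopy_append_iff.1 h
    have key : ∀ c, B ++ [c] <:+: invText T → B ++ [c] <+: invText (T.take q) := by
      intro c hc
      obtain ⟨e, he, hc⟩ := infix_invText_iff.1 hc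
      have := h5 e (((lsufLocus_prefix_iff he).1
        (hB.2.1.trans ((List.prefix_append _ _).trans hc))).mono h.le_lsuf)
      rwa [show e = q by omega] at hc
    rcases hB.1 with h0 | h0 | ⟨c, d, hcd, hc, hd⟩
    · have := hB.2.1
      rw [h0, List.prefix_nil] at this
      exact absurd (Or.inl this) hn
    · exact h0
    · exact absurd (append_singleton_prefix_inj (key c hc) (key d hd)) hcd
  · intro h
    obtain ⟨e, he, rfl⟩ := isLeaf_invText_iff.1 h
    obtain ⟨s, hs, -⟩ := exists_isSSufCopy hpos he ((lsufLocus_prefix_iff he).1 hB.2.1) (by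
      intro f hf
      have hfl := hf.2.2.2.1
      simp only [List.length_append, List.length_singleton] at hfl
      by_cases hfn : f = T.length + 1
      · exact Or.inr hfn
      have hf' : f ≤ T.length := by omega
      left
      exact (invText_take_prefix he hf' (hB.2.2 _
        (Or.inr (Or.inl (isLeaf_invText_iff.2 ⟨f, hf', rfl⟩))) ((lsufLocus_prefix_iff hf').2 hf))).symm)
    exact ⟨s, e, hs⟩

theorem IsSSufCopy.length_eq_of_isParent {s q : ℕ} {Y : List (Option α)}
    (h : IsSSufCopy (T ++ [a]) s q) (hY : IsParent (invText (T ++ [a])) Y (lsufLocus T a)) :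
    q + 1 - s = Y.length + 1 := by
  obtain ⟨h1, h2, h3, h4, h5, h6⟩ := isSSufCopy_append_iff.1 h
  have hle := h.le_lsuf
  have hm := lsuf_append_le (T := T) (a := a)
  obtain ⟨hY1, hY2, hY3, hY4⟩ := hY
  have hYlt : Y.length < lsuf (T ++ [a]) := by
    have := hY2.length_le
    rw [length_lsufLocus] at this
    refine lt_of_le_of_ne this fun he => hY3 (hY2.eq_of_length ?_)
    rw [he, length_lsufLocus]
  have hYp : Y <+: invText (T ++ [a]) := hY2.trans lsufLocus_prefix
  have hYl : Y = locus (T ++ [a]) Y.length (T.length + 1) := by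
    rw [← take_append_all] at hYp
    rcases prefix_invText_cases (by simp) hYp with h | ⟨-, h⟩
    · have := congrArg List.length h
      rw [take_append_all, length_invText, List.length_append, List.length_singleton] at this
      omega
    · exact h
  -- Otherwise `Y` ends only at `q` and j + 1; both leaves continue along `X`, so `Y` would not
  -- branch.
  have lower : ¬ q + 1 - s ≤ Y.length := by
    intro hcon
    obtain ⟨x, hx⟩ := exists_append_singleton_prefix hY2 hY3
    have key : ∀ c, Y ++ [c] <:+: invText (T ++ [a]) → c = x := by
      intro c hc
      obtain ⟨e, he, hc⟩ := infix_invText_iff.1 hc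
      have hYe : Agree (T ++ [a]) Y.length (T.length + 1) e := by
        rw [← locus_prefix_iff (by omega) (by simp) he, ← hYl]
        exact (List.prefix_append _ _).trans hc
      have hXe : lsufLocus T a <+: invText ((T ++ [a]).take e) := by
        rcases h5 e (hYe.mono hcon) with rfl | rfl
        · rw [take_append_eq h3]
          exact (lsufLocus_prefix_iff h3).2 h.agree_lsuf
        · rw [take_append_all]
          exact lsufLocus_prefix
      exact append_singleton_prefix_inj hc (hx.trans hXe)
    rcases hY1 with rfl | h0 | ⟨c, d, hcd, hc, hd⟩
    · simp at hcon
      omega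
    · obtain ⟨e, -, he⟩ := isLeaf_invText_iff.1 h0
      refine none_not_mem_locus (T ++ [a]) Y.length (T.length + 1) ?_
      rw [← hYl, he]
      exact none_mem_invText _
    · exact hcd ((key c hc).trans (key d hd).symm)
  -- Otherwise the suffix of length |Y| + 1 has a third occurrence, and the path to its leaf
  -- branches off strictly between `Y` and `X`.
  have upper : ¬ Y.length + 1 < q + 1 - s := by
    intro hcon
    obtain ⟨e, hne, he, hA⟩ := h6 (Y.length + 1) (by omega) hcon
    obtain ⟨P, hP1, hP2, hP3, hP4⟩ :=
      exists_longest_common_prefix (invText (T.take e)) (lsufLocus T a)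
    have hVX : locus (T ++ [a]) (Y.length + 1) (T.length + 1) <+: lsufLocus T a := by
      refine List.prefix_of_prefix_length_le (locus_append_prefix (by omega)) lsufLocus_prefix ?_
      rw [length_locus (by omega) (by simp), length_lsufLocus]
      omega
    have hV := (hP3 _ ((locus_append_prefix_iff (by omega) he).2 hA) hVX).length_le
    rw [length_locus (by omega) (by simp)] at hV
    rcases hP4 with rfl | rfl | ⟨c, d, hcd, hc, hd⟩
    · exact none_not_mem_locus _ _ _ (hP2.subset (none_mem_invText _) : none ∈ lsufLocus T a)
    · have := h5 e (((lsufLocus_prefix_iff he).1 hP1).mono hle)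
      omega
    · have := (hY4 P (Or.inr (Or.inr ⟨c, d, hcd, ?_, (hd.trans lsufLocus_prefix).isInfix⟩)) hP2
        ?_).length_le
      · omega
      · rw [invText_append]
        exact (infix_invText_iff.2 ⟨e, he, hc⟩).trans (List.suffix_cons _ _).isInfix
      · rintro rfl
        have := hd.length_le
        simp at this
  omega

theorem isSSufCopy_of_isLeaf {B Y : List (Option α)}
    (hn : ¬ IsNode (invText T) (lsufLocus T a))
    (hB : IsLowerNode (invText T) (lsufLocus T a) B)
    (hY : IsParent (invText (T ++ [a])) Y (lsufLocus T a)) (hl : IsLeaf (invText T) B) :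
    IsSSufCopy (T ++ [a]) (B.length - 1 - Y.length) (B.length - 1) ∧
      Y.length + 1 ≤ B.length - 1 := by
  obtain ⟨s, q, h⟩ := exists_isSSuf_iff.1 ((exists_isSSuf_iff_isLeaf hn hB).2 hl)
  have hlen := h.length_eq_of_isParent hY
  obtain ⟨h1, h2, h3, h4, h5, -⟩ := isSSufCopy_append_iff.1 h
  obtain ⟨e, he, rfl⟩ := isLeaf_invText_iff.1 hl
  have := h5 e (((lsufLocus_prefix_iff he).1 hB.2.1).mono h.le_lsuf)
  rw [length_invText, List.length_take, min_eq_left he, Nat.add_sub_cancel,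
    show e = q by omega, show q - Y.length = s by omega]
  exact ⟨h, by omega⟩

theorem suf_prefix_lsufLocus {l : ℕ} (hl : l ≤ lsuf (T ++ [a])) :
    (suf (T ++ [a]) l).reverse.map some <+: lsufLocus T a := by
  have hm := lsuf_append_le (T := T) (a := a)
  rw [reverse_suf_map (by simp; omega), List.length_append, List.length_singleton]
  refine List.prefix_of_prefix_length_le (locus_append_prefix (by omega)) lsufLocus_prefix ?_
  rwa [length_locus (by omega) (by simp), length_lsufLocus]

theorem reading_off_suffixes (T : List α) (a : α) :
    ∃ X, IsInsertionPoint (some a) (invText T) X ∧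
      X = (suf (T ++ [a]) (lsuf (T ++ [a]))).reverse.map some ∧
      (IsNode (invText T) X → ¬ ∃ l, IsSSuf (T ++ [a]) l) ∧
      (¬ IsNode (invText T) X →
        IsNode (invText (T ++ [a])) X ∧
        ∃ B Y, IsLowerNode (invText T) X B ∧ IsParent (invText (T ++ [a])) Y X ∧
          ((∃ l, IsSSuf (T ++ [a]) l) ↔ IsLeaf (invText T) B) ∧
          (IsLeaf (invText T) B →
            IsSSuf (T ++ [a]) (Y.length + 1) ∧
            (suf (T ++ [a]) (Y.length + 1)).reverse.map some <+: X ∧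
            IsSSufCopy (T ++ [a]) (B.length - 1 - Y.length) (B.length - 1))) := by
  refine ⟨lsufLocus T a, isInsertionPoint_lsufLocus T a, lsufLocus_eq,
    not_exists_isSSuf_of_isNode, fun hn => ⟨isNode_append_lsufLocus T a, ?_⟩⟩
  obtain ⟨B, hB⟩ := exists_isLowerNode (isInsertionPoint_lsufLocus T a).2.1
  obtain ⟨Y, hY⟩ := exists_isParent (S := invText (T ++ [a])) (X := lsufLocus T a)
    fun h => hn (Or.inl h)
  refine ⟨B, Y, hB, hY, exists_isSSuf_iff_isLeaf hn hB, fun hl => ?_⟩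
  obtain ⟨h, hle⟩ := isSSufCopy_of_isLeaf hn hB hY hl
  have hs := h.2.2.2.1
  have hlen := h.le_lsuf
  rw [show B.length - 1 + 1 - (B.length - 1 - Y.length) = Y.length + 1 by omega] at hs hlen
  exact ⟨hs, suf_prefix_lsufLocus hlen, h⟩

end InsertionPoint

/-! ### Reasoning about programs -/

section Programs

variable {w : ℕ}

/-- This gives `1 ≤ t n`, which absorbs additive constants into multiples of `t n`. -/
theorem Exec.one_le_steps {p : Cmd} {s s' : State w} {k m : ℕ} (h : Exec p s s' k m) : 1 ≤ k := by
  induction h <;> omega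

theorem Runs.one_le_steps {p : Cmd} {s : State w} {k m : ℕ} {post : State w → Prop}
    (h : Runs p s k m post) : 1 ≤ k := by
  obtain ⟨s', k', m', h, hk, -⟩ := h
  exact h.one_le_steps.trans hk

theorem Runs.mono {p : Cmd} {s : State w} {k m k' m' : ℕ} {post post' : State w → Prop}
    (h : Runs p s k m post) (hk : k ≤ k') (hm : m ≤ m') (hp : ∀ s', post s' → post' s') :
    Runs p s k' m' post' := by
  obtain ⟨s', k₁, m₁, h, h1, h2, h3⟩ := h
  exact ⟨s', k₁, m₁, h, h1.trans hk, h2.trans hm, hp s' h3⟩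

theorem Runs.bind {p q : Cmd} {s : State w} {k₁ k m : ℕ} {post₁ post : State w → Prop}
    (h : Runs p s k₁ m post₁) (hk : k₁ ≤ k)
    (h' : ∀ s', post₁ s' → Runs q s' (k - k₁) m post) : Runs (.seq p q) s k m post := by
  obtain ⟨s₁, a₁, m₁, h1, h2, h3, h4⟩ := h
  obtain ⟨s₂, a₂, m₂, g1, g2, g3, g4⟩ := h' s₁ h4
  exact ⟨s₂, _, _, h1.seq g1, by omega, max_le h3 g3, g4⟩

theorem Runs.cond {r : ℕ} {p q : Cmd} {s : State w} {k m : ℕ} {post : State w → Prop}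
    (hk : 1 ≤ k) (h : s.reg r ≠ 0 → Runs p s (k - 1) m post)
    (h' : s.reg r = 0 → Runs q s (k - 1) m post) : Runs (.cond r p q) s k m post := by
  by_cases hr : s.reg r = 0
  · obtain ⟨s₁, a₁, m₁, h1, h2, h3, h4⟩ := h' hr
    exact ⟨s₁, _, _, .condFalse hr h1, by omega, h3, h4⟩
  · obtain ⟨s₁, a₁, m₁, h1, h2, h3, h4⟩ := h hr
    exact ⟨s₁, _, _, .condTrue hr h1, by omega, h3, h4⟩

theorem Runs.const {d n m : ℕ} {s : State w} {post : State w → Prop}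
    (h : post (s.setReg d (BitVec.ofNat w n))) : Runs (.const d n) s 1 m post :=
  ⟨_, _, _, .const d n s, le_rfl, Nat.zero_le _, h⟩

theorem Runs.op {o : BinOp} {d a b m : ℕ} {s : State w} {post : State w → Prop}
    (h : post (s.setReg d (o.eval (s.reg a) (s.reg b)))) : Runs (.op o d a b) s 1 m post :=
  ⟨_, _, _, .op o d a b s, le_rfl, Nat.zero_le _, h⟩

theorem Runs.load {d a m : ℕ} {s : State w} {post : State w → Prop}
    (hm : (s.reg a).toNat + 1 ≤ m) (h : post (s.setReg d (s.mem (s.reg a)))) :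
    Runs (.load d a) s 1 m post :=
  ⟨_, _, _, .load d a s, le_rfl, hm, h⟩

theorem Runs.store {a b m : ℕ} {s : State w} {post : State w → Prop}
    (hm : (s.reg a).toNat + 1 ≤ m) (h : post (s.setMem (s.reg a) (s.reg b))) :
    Runs (.store a b) s 1 m post :=
  ⟨_, _, _, .store a b s, le_rfl, hm, h⟩

theorem ofNat_inj_of_lt {x y : ℕ} (hx : x < 2 ^ w) (hy : y < 2 ^ w) :
    BitVec.ofNat w x = BitVec.ofNat w y ↔ x = y := by
  refine ⟨fun h => ?_, fun h => h ▸ rfl⟩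
  have := congrArg BitVec.toNat h
  rwa [BitVec.toNat_ofNat, BitVec.toNat_ofNat, Nat.mod_eq_of_lt hx, Nat.mod_eq_of_lt hy] at this

theorem ofNat_eq_zero_of_lt {x : ℕ} (hx : x < 2 ^ w) : BitVec.ofNat w x = 0 ↔ x = 0 :=
  ofNat_inj_of_lt hx (Nat.two_pow_pos w)

theorem BinOp.eval_add (x y : ℕ) :
    BinOp.add.eval (BitVec.ofNat w x) (BitVec.ofNat w y) = BitVec.ofNat w (x + y) :=
  (BitVec.ofNat_add x y).symm

theorem BinOp.eval_mul (x y : ℕ) :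
    BinOp.mul.eval (BitVec.ofNat w x) (BitVec.ofNat w y) = BitVec.ofNat w (x * y) :=
  (BitVec.ofNat_mul x y).symm

theorem BinOp.eval_sub {x y : ℕ} (h : y ≤ x) :
    BinOp.sub.eval (BitVec.ofNat w x) (BitVec.ofNat w y) = BitVec.ofNat w (x - y) := by
  have := BinOp.eval_add (w := w) (x - y) y
  rw [Nat.sub_add_cancel h] at this
  rw [← this]
  simp [BinOp.eval]

theorem BinOp.eval_or_self (x : BitVec w) : BinOp.or.eval x x = x :=
  BitVec.or_self

theorem BinOp.eval_lt {x y : ℕ} (hx : x < 2 ^ w) (hy : y < 2 ^ w) :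
    BinOp.lt.eval (BitVec.ofNat w x) (BitVec.ofNat w y) =
      BitVec.ofNat w (if x < y then 1 else 0) := by
  simp only [BinOp.eval, BitVec.toNat_ofNat, Nat.mod_eq_of_lt hx, Nat.mod_eq_of_lt hy]
  split_ifs <;> rfl

theorem BinOp.eval_eq {x y : ℕ} (hx : x < 2 ^ w) (hy : y < 2 ^ w) :
    BinOp.eq.eval (BitVec.ofNat w x) (BitVec.ofNat w y) =
      BitVec.ofNat w (if x = y then 1 else 0) := by
  simp only [BinOp.eval, ofNat_inj_of_lt hx hy]
  split_ifs <;> rfl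

/-! ### Embedding a program into a machine with further registers and memory cells -/

/-- Register `r` is moved to register `r + 16`, and the memory cell `x` is moved to `3 * x`.
Register `15` is used for addresses. -/
def Cmd.embed : Cmd → Cmd
  | .const d n => .const (d + 16) n
  | .op o d a b => .op o (d + 16) (a + 16) (b + 16)
  | .load d a => .seq (.const 15 3) (.seq (.op .mul 15 15 (a + 16)) (.load (d + 16) 15))
  | .store a b => .seq (.const 15 3) (.seq (.op .mul 15 15 (a + 16)) (.store 15 (b + 16)))
  | .seq p q => .seq p.embed q.embed
  | .cond r p q => .cond (r + 16) p.embed q.embed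
  | .loop r p => .loop (r + 16) p.embed

/-- The state `q` contains the state `s` of an embedded program. -/
structure Simulates (s q : State w) : Prop where
  reg : ∀ r, q.reg (r + 16) = s.reg r
  mem : ∀ x, 3 * x + 2 < 2 ^ w → q.mem (BitVec.ofNat w (3 * x)) = s.mem (BitVec.ofNat w x)

/-- `q'` arises from `q` without changes outside of the embedded state. -/
structure Frame (q q' : State w) : Prop where
  reg : ∀ r, r < 15 → q'.reg r = q.reg r
  mem : ∀ y : BitVec w, y.toNat % 3 ≠ 0 → q'.mem y = q.mem y

theorem Frame.refl (q : State w) : Frame q q := ⟨fun _ _ => rfl, fun _ _ => rfl⟩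

theorem Frame.trans {q q' q'' : State w} (h : Frame q q') (h' : Frame q' q'') : Frame q q'' :=
  ⟨fun r hr => (h'.reg r hr).trans (h.reg r hr), fun y hy => (h'.mem y hy).trans (h.mem y hy)⟩

theorem Simulates.setReg {s q : State w} (h : Simulates s q) (d : ℕ) (v : BitVec w) :
    Simulates (s.setReg d v) (q.setReg (d + 16) v) := by
  refine ⟨fun r => ?_, h.mem⟩
  simp only [State.setReg, Function.update_apply, Nat.add_right_cancel_iff, h.reg]

theorem Simulates.setReg_right {s q : State w} (h : Simulates s q) {d : ℕ} (hd : d < 16)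
    (v : BitVec w) : Simulates s (q.setReg d v) := by
  refine ⟨fun r => ?_, h.mem⟩
  simp only [State.setReg, Function.update_apply, if_neg (show r + 16 ≠ d by omega), h.reg]

theorem Frame.setReg {q : State w} {d : ℕ} (hd : 15 ≤ d) (v : BitVec w) : Frame q (q.setReg d v) :=
  ⟨fun r hr => by simp only [State.setReg, Function.update_apply, if_neg (show r ≠ d by omega)],
    fun _ _ => rfl⟩

theorem toNat_mul_three {x : BitVec w} (hx : 3 * (x.toNat + 1) ≤ 2 ^ w) :
    BinOp.mul.eval (BitVec.ofNat w 3) x = BitVec.ofNat w (3 * x.toNat) ∧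
      (BitVec.ofNat w (3 * x.toNat)).toNat = 3 * x.toNat := by
  constructor
  · rw [← BinOp.eval_mul, BitVec.ofNat_toNat, BitVec.setWidth_eq]
  · rw [BitVec.toNat_ofNat, Nat.mod_eq_of_lt (by omega)]

/-- A load or store becomes three instructions, whence the factor 3 in time; the one in space comes
from spreading the cells. The bound `3 * m ≤ 2 ^ w` keeps the scaled addresses from wrapping around.
-/
theorem Exec.embed {p : Cmd} {s s' : State w} {k m : ℕ} (h : Exec p s s' k m) :
    ∀ {q : State w}, 3 * m ≤ 2 ^ w → Simulates s q → Runs p.embed q (3 * k) (3 * m)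
      (fun q' => Frame q q' ∧ Simulates s' q') := by
  induction h with
  | const d n s =>
    intro q _ hs
    exact (Runs.const ⟨Frame.setReg (by omega) _, hs.setReg d _⟩).mono (by omega) le_rfl fun _ h => h
  | op o d a b s =>
    intro q _ hs
    refine Runs.mono (Runs.op (m := 0) ⟨Frame.setReg (by omega) _, ?_⟩) (by omega) le_rfl fun _ h => h
    rw [hs.reg, hs.reg]
    exact hs.setReg d _
  | load d a s =>
    intro q hm hs
    obtain ⟨e1, e2⟩ := toNat_mul_three hm
    refine Runs.bind (Runs.const rfl) (by omega) ?_
    rintro _ rfl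
    refine Runs.bind (Runs.op rfl) (by omega) ?_
    rintro _ rfl
    have e3 : BinOp.mul.eval ((q.setReg 15 (BitVec.ofNat w 3)).reg 15)
        ((q.setReg 15 (BitVec.ofNat w 3)).reg (a + 16)) =
          BitVec.ofNat w (3 * (s.reg a).toNat) := by
      rw [← e1, ← hs.reg]
      simp [State.setReg]
    rw [e3]
    refine Runs.load ?_ ⟨?_, ?_⟩
    · simp only [State.setReg, Function.update_self, e2]
      omega
    · exact ((Frame.setReg (by omega) _).trans (Frame.setReg (by omega) _)).trans
        (Frame.setReg (by omega) _)
    · have e4 := hs.mem (s.reg a).toNat (by omega)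
      rw [BitVec.ofNat_toNat, BitVec.setWidth_eq] at e4
      have := ((hs.setReg_right (d := 15) (by omega) (BitVec.ofNat w 3)).setReg_right (d := 15)
        (by omega) (BitVec.ofNat w (3 * (s.reg a).toNat))).setReg d (s.mem (s.reg a))
      rw [← e4] at this ⊢
      simpa [State.setReg] using this
  | store a b s =>
    intro q hm hs
    obtain ⟨e1, e2⟩ := toNat_mul_three hm
    refine Runs.bind (Runs.const rfl) (by omega) ?_
    rintro _ rfl
    refine Runs.bind (Runs.op rfl) (by omega) ?_
    rintro _ rfl
    have e3 : BinOp.mul.eval ((q.setReg 15 (BitVec.ofNat w 3)).reg 15)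
        ((q.setReg 15 (BitVec.ofNat w 3)).reg (a + 16)) =
          BitVec.ofNat w (3 * (s.reg a).toNat) := by
      rw [← e1, ← hs.reg]
      simp [State.setReg]
    rw [e3]
    have hsim := (hs.setReg_right (d := 15) (by omega) (BitVec.ofNat w 3)).setReg_right (d := 15)
        (by omega) (BitVec.ofNat w (3 * (s.reg a).toNat))
    have hfr := (Frame.setReg (q := q) (d := 15) (by omega) (BitVec.ofNat w 3)).trans
      (Frame.setReg (d := 15) (by omega) (BitVec.ofNat w (3 * (s.reg a).toNat)))
    generalize hq : (q.setReg 15 (BitVec.ofNat w 3)).setReg 15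
      (BitVec.ofNat w (3 * (s.reg a).toNat)) = q' at hsim hfr
    have h15 : q'.reg 15 = BitVec.ofNat w (3 * (s.reg a).toNat) := by
      rw [← hq]
      simp [State.setReg]
    refine Runs.store ?_ ⟨⟨hfr.reg, fun y hy => ?_⟩, ⟨hsim.reg, fun x hx => ?_⟩⟩
    · rw [h15, e2]
      omega
    · simp only [State.setMem, h15, Function.update_apply]
      rw [if_neg, hfr.mem y hy]
      rintro rfl
      rw [e2] at hy
      omega
    · simp only [State.setMem, h15, Function.update_apply, hsim.reg]
      have hax : BitVec.ofNat w x = s.reg a ↔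
          BitVec.ofNat w (3 * x) = BitVec.ofNat w (3 * (s.reg a).toNat) := by
        rw [ofNat_inj_of_lt (by omega) (by omega)]
        conv_lhs => rw [← BitVec.setWidth_eq (s.reg a), ← BitVec.ofNat_toNat]
        rw [ofNat_inj_of_lt (by omega) (by omega)]
        omega
      simp only [hax, hsim.mem x hx]
  | seq _ _ ih₁ ih₂ =>
    intro q hm hs
    refine Runs.bind ((ih₁ (by omega) hs).mono le_rfl (by omega) fun _ h => h) (by omega) ?_
    rintro q' ⟨hf, hs'⟩
    refine (ih₂ (by omega) hs').mono (by omega) (by omega) ?_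
    rintro q'' ⟨hf', hs''⟩
    exact ⟨hf.trans hf', hs''⟩
  | condTrue hr _ ih =>
    intro q hm hs
    refine Runs.cond (by omega) (fun _ => (ih hm hs).mono (by omega) le_rfl fun _ h => h) fun h => ?_
    rw [hs.reg] at h
    exact absurd h hr
  | condFalse hr _ ih =>
    intro q hm hs
    refine Runs.cond (by omega) (fun h => ?_) (fun _ => (ih hm hs).mono (by omega) le_rfl fun _ h => h)
    rw [hs.reg] at h
    exact absurd hr h
  | loopDone hr =>
    intro q hm hs
    rw [← hs.reg] at hr
    exact ⟨q, 1, 0, .loopDone hr, by omega, by omega, Frame.refl q, hs⟩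
  | loopStep hr _ _ ih₁ ih₂ =>
    intro q hm hs
    rw [← hs.reg] at hr
    obtain ⟨q₁, a₁, m₁, h1, h2, h3, h4, h5⟩ := ih₁ (by omega) hs
    obtain ⟨q₂, a₂, m₂, g1, g2, g3, g4, g5⟩ := ih₂ (by omega) h5
    exact ⟨q₂, _, _, .loopStep hr h1 g1, by omega, by omega, h4.trans g4, g5⟩

theorem Runs.embed {p : Cmd} {s q : State w} {k m : ℕ} {post : State w → Prop}
    (h : Runs p s k m post) (hm : 3 * m ≤ 2 ^ w) (hs : Simulates s q) :
    Runs p.embed q (3 * k) (3 * m) (fun q' => Frame q q' ∧ ∃ s', Simulates s' q' ∧ post s') := by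
  obtain ⟨s', k', m', h, hk, hm', hp⟩ := h
  exact (h.embed (by omega) hs).mono (by omega) (by omega) fun q' hq => ⟨hq.1, s', hq.2, hp⟩

end Programs

/-! ### The program that maintains the minimal unique substrings -/

/-! ### Two arrays interleaved with the memory of the embedded program -/

section Cells

variable {w : ℕ}

/-- A set of pairs is stored in two interleaved arrays, which map the first components to the second
components and vice versa. -/
structure StoresPairs (mem : BitVec w → BitVec w) (M : Set (ℕ × ℕ)) : Prop where
  start_mem : ∀ b e, (b, e) ∈ M → 3 * b + 2 < 2 ^ w →
    mem (BitVec.ofNat w (3 * b + 1)) = BitVec.ofNat w e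
  start_none : ∀ b, 3 * b + 2 < 2 ^ w → (∀ e, (b, e) ∉ M) → mem (BitVec.ofNat w (3 * b + 1)) = 0
  end_mem : ∀ b e, (b, e) ∈ M → 3 * e + 2 < 2 ^ w →
    mem (BitVec.ofNat w (3 * e + 2)) = BitVec.ofNat w b
  end_none : ∀ e, 3 * e + 2 < 2 ^ w → (∀ b, (b, e) ∉ M) → mem (BitVec.ofNat w (3 * e + 2)) = 0

theorem update_ofNat {f : BitVec w → BitVec w} {x y : ℕ} {v : BitVec w} (hx : x < 2 ^ w)
    (hy : y < 2 ^ w) : Function.update f (BitVec.ofNat w y) v (BitVec.ofNat w x) =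
      if x = y then v else f (BitVec.ofNat w x) := by
  simp only [Function.update_apply, ofNat_inj_of_lt hx hy]

/-- The last two hypotheses say that neither cell is occupied by another pair, so overwriting loses
nothing. -/
theorem StoresPairs.insert {mem : BitVec w → BitVec w} {M : Set (ℕ × ℕ)} (h : StoresPairs mem M)
    {b e : ℕ} (hb : 3 * b + 2 < 2 ^ w) (he : 3 * e + 2 < 2 ^ w)
    (h₁ : ∀ e', (b, e') ∈ M → e' = e) (h₂ : ∀ b', (b', e) ∈ M → b' = b) :
    StoresPairs (Function.update (Function.update mem (BitVec.ofNat w (3 * b + 1)) (BitVec.ofNat w e))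
      (BitVec.ofNat w (3 * e + 2)) (BitVec.ofNat w b)) (insert (b, e) M) := by
  constructor
  · intro b' e' hm hlt
    rw [update_ofNat (by omega) (by omega), update_ofNat (by omega) (by omega), if_neg (by omega)]
    rcases hm with hm | hm
    · simp only [Prod.mk.injEq] at hm
      rw [if_pos (by omega), hm.2]
    · split_ifs with hbb
      · obtain rfl : b' = b := by omega
        rw [h₁ e' hm]
      · exact h.start_mem b' e' hm hlt
  · intro b' hlt hn
    have := hn e
    rw [update_ofNat (by omega) (by omega), update_ofNat (by omega) (by omega), if_neg (by omega), if_neg,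
      h.start_none b' hlt fun e' he' => hn e' (Or.inr he')]
    intro hbb
    obtain rfl : b' = b := by omega
    exact this (Or.inl rfl)
  · intro b' e' hm hlt
    rw [update_ofNat (by omega) (by omega), update_ofNat (by omega) (by omega)]
    rcases hm with hm | hm
    · simp only [Prod.mk.injEq] at hm
      rw [if_pos (by omega), hm.1]
    · split_ifs with hbb hbb'
      · obtain rfl : e' = e := by omega
        rw [h₂ b' hm]
      · omega
      · exact h.end_mem b' e' hm hlt
  · intro e' hlt hn
    have := hn b
    rw [update_ofNat (by omega) (by omega), update_ofNat (by omega) (by omega), if_neg, if_neg (by omega),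
      h.end_none e' hlt fun b' hb' => hn b' (Or.inr hb')]
    intro hbb
    obtain rfl : e' = e := by omega
    exact this (Or.inl rfl)

theorem StoresPairs.erase {mem : BitVec w → BitVec w} {M : Set (ℕ × ℕ)} (h : StoresPairs mem M)
    {b e : ℕ} (hb : 3 * b + 2 < 2 ^ w) (he : 3 * e + 2 < 2 ^ w) (hbe : (b, e) ∈ M)
    (h₁ : ∀ e', (b, e') ∈ M → e' = e) (h₂ : ∀ b', (b', e) ∈ M → b' = b) :
    StoresPairs (Function.update (Function.update mem (BitVec.ofNat w (3 * b + 1)) 0)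
      (BitVec.ofNat w (3 * e + 2)) 0) (M \ {(b, e)}) := by
  constructor
  · rintro b' e' ⟨hm, hne⟩ hlt
    rw [update_ofNat (by omega) (by omega), update_ofNat (by omega) (by omega), if_neg (by omega), if_neg,
      h.start_mem b' e' hm hlt]
    intro hbb
    obtain rfl : b' = b := by omega
    rw [h₁ e' hm] at hne
    exact hne rfl
  · intro b' hlt hn
    rw [update_ofNat (by omega) (by omega), update_ofNat (by omega) (by omega), if_neg (by omega)]
    split_ifs with hbb
    · rfl
    · refine h.start_none b' hlt fun e' he' => hn e' ⟨he', fun hc => hbb ?_⟩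
      have := congrArg Prod.fst hc
      simp only at this
      omega
  · rintro b' e' ⟨hm, hne⟩ hlt
    rw [update_ofNat (by omega) (by omega), update_ofNat (by omega) (by omega), if_neg, if_neg (by omega),
      h.end_mem b' e' hm hlt]
    intro hbb
    obtain rfl : e' = e := by omega
    rw [h₂ b' hm] at hne
    exact hne rfl
  · intro e' hlt hn
    rw [update_ofNat (by omega) (by omega), update_ofNat (by omega) (by omega)]
    split_ifs with hbb
    · rfl
    · omega
    · refine h.end_none e' hlt fun b' hb' => hn b' ⟨hb', fun hc => hbb ?_⟩
      have := congrArg Prod.snd hc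
      simp only at this
      omega

/-- Load the address `3 * r_r + off` into register `15`. -/
def cellAddress (off r : ℕ) (p : Cmd) : Cmd :=
  .seq (.const 15 3) (.seq (.op .mul 15 15 r) (.seq (.const 14 off) (.seq (.op .add 15 15 14) p)))

theorem runs_cellAddress {off r i k m : ℕ} {p : Cmd} {q : State w} {post : State w → Prop}
    (hr : r < 14) (hi : q.reg r = BitVec.ofNat w i)
    (h : ∀ q' : State w, (∀ r, r ≠ 14 → r ≠ 15 → q'.reg r = q.reg r) → q'.mem = q.mem →
      q'.reg 15 = BitVec.ofNat w (3 * i + off) → Runs p q' k m post) :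
    Runs (cellAddress off r p) q (k + 4) m post := by
  refine Runs.bind (Runs.const rfl) (by omega) ?_
  rintro _ rfl
  refine Runs.bind (Runs.op rfl) (by omega) ?_
  rintro _ rfl
  refine Runs.bind (Runs.const rfl) (by omega) ?_
  rintro _ rfl
  refine Runs.bind (Runs.op rfl) (by omega) ?_
  rintro _ rfl
  refine (h _ ?_ ?_ ?_).mono (by omega) le_rfl fun _ h => h
  · intro r h1 h2
    simp [State.setReg, Function.update_apply, h1, h2]
  · rfl
  · have : r ≠ 15 := by omega
    simp [State.setReg, this, hi, BinOp.eval_mul, BinOp.eval_add]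

/-- `r_d := mem[3 * r_r + off]` -/
def readCell (off d r : ℕ) : Cmd := cellAddress off r (.load d 15)

/-- `mem[3 * r_r + off] := r_b` -/
def writeCell (off r b : ℕ) : Cmd := cellAddress off r (.store 15 b)

theorem runs_readCell {off d r i m : ℕ} {q : State w} {post : State w → Prop}
    (hr : r < 14) (hi : q.reg r = BitVec.ofNat w i) (hlt : 3 * i + off < 2 ^ w)
    (hm : 3 * i + off + 1 ≤ m)
    (h : ∀ q' : State w, (∀ r, r ≠ d → r ≠ 14 → r ≠ 15 → q'.reg r = q.reg r) → q'.mem = q.mem →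
      q'.reg d = q.mem (BitVec.ofNat w (3 * i + off)) → post q') :
    Runs (readCell off d r) q 5 m post := by
  refine runs_cellAddress (k := 1) hr hi fun q' h1 h2 h3 => Runs.load ?_ (h _ ?_ h2 ?_)
  · rw [h3, BitVec.toNat_ofNat, Nat.mod_eq_of_lt hlt]
    exact hm
  · intro r g1 g2 g3
    simp only [State.setReg, Function.update_apply, if_neg g1, h1 r g2 g3]
  · simp only [State.setReg, Function.update_self, h2, h3]

theorem runs_writeCell {off r b i m : ℕ} {q : State w} {post : State w → Prop}
    (hr : r < 14) (hb : b < 14) (hi : q.reg r = BitVec.ofNat w i) (hlt : 3 * i + off < 2 ^ w)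
    (hm : 3 * i + off + 1 ≤ m)
    (h : ∀ q' : State w, (∀ r, r ≠ 14 → r ≠ 15 → q'.reg r = q.reg r) →
      q'.mem = Function.update q.mem (BitVec.ofNat w (3 * i + off)) (q.reg b) → post q') :
    Runs (writeCell off r b) q 5 m post := by
  refine runs_cellAddress (k := 1) hr hi fun q' h1 h2 h3 => Runs.store ?_ (h _ ?_ ?_)
  · rw [h3, BitVec.toNat_ofNat, Nat.mod_eq_of_lt hlt]
    exact hm
  · exact h1
  · simp only [State.setMem, h2, h3, h1 b (by omega) (by omega)]

/-- The state `q` contains the state `s` of an embedded program, the values `v` of the registers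
with numbers below `13`, and the set `M` of pairs. -/
structure Stores (q s : State w) (v : ℕ → ℕ) (M : Set (ℕ × ℕ)) : Prop where
  sim : Simulates s q
  reg : ∀ r, r < 13 → q.reg r = BitVec.ofNat w (v r)
  pairs : StoresPairs q.mem M

theorem Stores.congr {q s : State w} {v : ℕ → ℕ} {M M' : Set (ℕ × ℕ)} (h : Stores q s v M)
    (hM : M = M') : Stores q s v M' :=
  hM ▸ h

theorem Stores.setReg {q s : State w} {v : ℕ → ℕ} {M : Set (ℕ × ℕ)} (h : Stores q s v M) {d x : ℕ}
    (hd : d < 13) : Stores (q.setReg d (BitVec.ofNat w x)) s (Function.update v d x) M := by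
  refine ⟨h.sim.setReg_right (by omega) _, fun r hr => ?_, h.pairs⟩
  simp only [State.setReg, Function.update_apply]
  split_ifs
  · rfl
  · exact h.reg r hr

theorem Stores.runs_const {q s : State w} {v : ℕ → ℕ} {M : Set (ℕ × ℕ)} (h : Stores q s v M)
    {d n m : ℕ} (hd : d < 13) :
    Runs (.const d n) q 1 m (fun q' => Stores q' s (Function.update v d n) M) :=
  Runs.const (h.setReg hd)

theorem Stores.runs_op {q s : State w} {v : ℕ → ℕ} {M : Set (ℕ × ℕ)} (h : Stores q s v M)
    {o : BinOp} {d a b m x : ℕ} (hd : d < 13) (ha : a < 13) (hb : b < 13)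
    (hx : o.eval (BitVec.ofNat w (v a)) (BitVec.ofNat w (v b)) = BitVec.ofNat w x) :
    Runs (.op o d a b) q 1 m (fun q' => Stores q' s (Function.update v d x) M) := by
  refine Runs.op ?_
  rw [h.reg a ha, h.reg b hb, hx]
  exact h.setReg hd

/-- Copy the result of an embedded program from its register `i` to register `d`. -/
def result (d i : ℕ) : Cmd := .op .or d (i + 16) (i + 16)

theorem Stores.runs_result {q s : State w} {v : ℕ → ℕ} {M : Set (ℕ × ℕ)} (h : Stores q s v M)
    {d i m x : ℕ} (hd : d < 13) (hx : s.reg i = BitVec.ofNat w x) :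
    Runs (result d i) q 1 m (fun q' => Stores q' s (Function.update v d x) M) := by
  refine Runs.op ?_
  rw [BinOp.eval_or_self, h.sim.reg, hx]
  exact h.setReg hd

/-- Run an embedded program whose argument is in register `r`. -/
def call (p : Cmd) (r : ℕ) : Cmd := .seq (.op .or 16 r r) p.embed

theorem StoresPairs.congr {mem mem' : BitVec w → BitVec w} {M : Set (ℕ × ℕ)}
    (h : StoresPairs mem M) (hm : ∀ y : BitVec w, y.toNat % 3 ≠ 0 → mem' y = mem y) :
    StoresPairs mem' M := by
  have key : ∀ i off, 1 ≤ off → off ≤ 2 → 3 * i + 2 < 2 ^ w →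
      mem' (BitVec.ofNat w (3 * i + off)) = mem (BitVec.ofNat w (3 * i + off)) := by
    intro i off h1 h2 h3
    refine hm _ ?_
    rw [BitVec.toNat_ofNat, Nat.mod_eq_of_lt (show 3 * i + off < 2 ^ w by omega)]
    omega
  constructor
  · intro b e hbe hlt
    rw [key b 1 (by omega) (by omega) hlt, h.start_mem b e hbe hlt]
  · intro b hlt hn
    rw [key b 1 (by omega) (by omega) hlt, h.start_none b hlt hn]
  · intro b e hbe hlt
    rw [key e 2 (by omega) (by omega) hlt, h.end_mem b e hbe hlt]
  · intro b hlt hn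
    rw [key b 2 (by omega) (by omega) hlt, h.end_none b hlt hn]

theorem Stores.runs_call {q s : State w} {v : ℕ → ℕ} {M : Set (ℕ × ℕ)} (h : Stores q s v M)
    {p : Cmd} {r k m m' : ℕ} {post : State w → Prop} (hr : r < 13)
    (hp : Runs p (s.setReg 0 (BitVec.ofNat w (v r))) k m post) (hm : 3 * m ≤ 2 ^ w)
    (hm' : 3 * m ≤ m') :
    Runs (call p r) q (3 * k + 1) m' (fun q' => ∃ s', Stores q' s' v M ∧ post s') := by
  refine Runs.bind (Runs.op rfl) (by omega) ?_
  rintro _ rfl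
  rw [BinOp.eval_or_self, h.reg r hr]
  refine (hp.embed hm (h.sim.setReg 0 _)).mono (by omega) hm' ?_
  rintro q' ⟨hf, s', hs', hpost⟩
  have hf' := (Frame.setReg (q := q) (d := 16) (by omega) (BitVec.ofNat w (v r))).trans hf
  exact ⟨s', ⟨hs', fun r hr => (hf'.reg r (by omega)).trans (h.reg r hr),
    h.pairs.congr hf'.mem⟩, hpost⟩

/-- Memory cells outside of the embedded memory can be changed. -/
theorem Simulates.of_update {s q q' : State w} (h : Simulates s q) {i off : ℕ} {x : BitVec w}
    (hr : ∀ r, r ≠ 13 → r ≠ 14 → r ≠ 15 → q'.reg r = q.reg r) (ho : 1 ≤ off) (ho' : off ≤ 2)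
    (hlt : 3 * i + off < 2 ^ w)
    (hm : q'.mem = Function.update q.mem (BitVec.ofNat w (3 * i + off)) x) : Simulates s q' := by
  refine ⟨fun r => ?_, fun y hy => ?_⟩
  · rw [hr _ (by omega) (by omega) (by omega), h.reg]
  · rw [hm, update_ofNat (by omega) hlt, if_neg (by omega), h.mem y hy]

/-- Write the contents of `x` and `y` to the cells of the start `r_b` and the end `r_e`. -/
def writePair (b e x y : ℕ) : Cmd := .seq (writeCell 1 b x) (writeCell 2 e y)

theorem Stores.runs_writePair {q s : State w} {v : ℕ → ℕ} {M M' : Set (ℕ × ℕ)}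
    (h : Stores q s v M) {b e x y m : ℕ} (hb : b < 13) (he : e < 13) (hx : x < 13) (hy : y < 13)
    (hbw : 3 * v b + 2 < 2 ^ w) (hew : 3 * v e + 2 < 2 ^ w) (hbm : 3 * v b + 3 ≤ m)
    (hem : 3 * v e + 3 ≤ m)
    (hM : StoresPairs (Function.update (Function.update q.mem (BitVec.ofNat w (3 * v b + 1))
      (BitVec.ofNat w (v x))) (BitVec.ofNat w (3 * v e + 2)) (BitVec.ofNat w (v y))) M') :
    Runs (writePair b e x y) q 10 m (fun q' => Stores q' s v M') := by
  refine Runs.bind (runs_writeCell (by omega) (by omega) (h.reg b hb) (by omega) (by omega)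
    fun q₁ h1 h2 => And.intro h1 h2) (by omega) ?_
  rintro q₁ ⟨h1, h2⟩
  have hs := h.sim.of_update (fun r _ g2 g3 => h1 r g2 g3) le_rfl (by omega) (by omega) h2
  have hr : ∀ r, r < 13 → q₁.reg r = BitVec.ofNat w (v r) := fun r hr => by
    rw [h1 r (by omega) (by omega), h.reg r hr]
  refine runs_writeCell (by omega) (by omega) (hr e he) (by omega) (by omega) fun q₂ h3 h4 => ?_
  refine ⟨hs.of_update (fun r _ g2 g3 => h3 r g2 g3) (by omega) le_rfl hew h4, fun r hr' => ?_, ?_⟩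
  · rw [h3 r (by omega) (by omega), hr r hr']
  · rw [h4, h2, hr y hy, h.reg x hx]
    exact hM

theorem Stores.runs_insert {q s : State w} {v : ℕ → ℕ} {M : Set (ℕ × ℕ)} (h : Stores q s v M)
    {b e m : ℕ} (hb : b < 13) (he : e < 13)
    (hbw : 3 * v b + 2 < 2 ^ w) (hew : 3 * v e + 2 < 2 ^ w) (hbm : 3 * v b + 3 ≤ m)
    (hem : 3 * v e + 3 ≤ m)
    (h₁ : ∀ e', (v b, e') ∈ M → e' = v e) (h₂ : ∀ b', (b', v e) ∈ M → b' = v b) :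
    Runs (writePair b e e b) q 10 m (fun q' => Stores q' s v (insert (v b, v e) M)) :=
  h.runs_writePair hb he he hb hbw hew hbm hem (h.pairs.insert hbw hew h₁ h₂)

theorem Stores.runs_erase {q s : State w} {v : ℕ → ℕ} {M : Set (ℕ × ℕ)} (h : Stores q s v M)
    {b e z m : ℕ} (hb : b < 13) (he : e < 13) (hz : z < 13) (hz0 : v z = 0)
    (hbw : 3 * v b + 2 < 2 ^ w) (hew : 3 * v e + 2 < 2 ^ w) (hbm : 3 * v b + 3 ≤ m)
    (hem : 3 * v e + 3 ≤ m) (hbe : (v b, v e) ∈ M)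
    (h₁ : ∀ e', (v b, e') ∈ M → e' = v e) (h₂ : ∀ b', (b', v e) ∈ M → b' = v b) :
    Runs (writePair b e z z) q 10 m (fun q' => Stores q' s v (M \ {(v b, v e)})) :=
  h.runs_writePair hb he hz hz hbw hew hbm hem
    (by rw [hz0]; exact h.pairs.erase hbw hew hbe h₁ h₂)

/-- Do nothing. -/
def skip : Cmd := .const 13 0

/-- Execute `p` if the cell `3 * r_r + off` contains `0`. -/
def ifZero (off r : ℕ) (p : Cmd) : Cmd := .seq (readCell off 13 r) (.cond 13 skip p)

theorem Stores.of_temp {q q' s : State w} {v : ℕ → ℕ} {M : Set (ℕ × ℕ)} (h : Stores q s v M)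
    (hr : ∀ r, r ≠ 13 → r ≠ 14 → r ≠ 15 → q'.reg r = q.reg r) (hm : q'.mem = q.mem) :
    Stores q' s v M := by
  refine ⟨⟨fun r => ?_, ?_⟩, fun r hr' => ?_, hm ▸ h.pairs⟩
  · rw [hr _ (by omega) (by omega) (by omega), h.sim.reg]
  · rw [hm]
    exact h.sim.mem
  · rw [hr r (by omega) (by omega) (by omega), h.reg r hr']

theorem Stores.runs_skip {q s : State w} {v : ℕ → ℕ} {M : Set (ℕ × ℕ)} (h : Stores q s v M)
    {m : ℕ} : Runs skip q 1 m (fun q' => Stores q' s v M) :=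
  Runs.const (h.of_temp (fun r h1 _ _ => by simp [State.setReg, h1]) rfl)

theorem Stores.runs_ifZero {q s : State w} {v : ℕ → ℕ} {M : Set (ℕ × ℕ)} (h : Stores q s v M)
    {off r k m : ℕ} {p : Cmd} {post : State w → Prop} (hr : r < 13) (hlt : 3 * v r + off < 2 ^ w)
    (hm : 3 * v r + off + 1 ≤ m) (hk : 1 ≤ k)
    (h₀ : q.mem (BitVec.ofNat w (3 * v r + off)) = 0 →
      ∀ q' : State w, Stores q' s v M → Runs p q' k m post)
    (h₁ : q.mem (BitVec.ofNat w (3 * v r + off)) ≠ 0 → ∀ q' : State w, Stores q' s v M → post q') :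
    Runs (ifZero off r p) q (k + 6) m post := by
  refine Runs.bind (runs_readCell (by omega) (h.reg r hr) hlt hm
    fun q₁ g1 g2 g3 => And.intro g1 (And.intro g2 g3)) (by omega) ?_
  rintro q₁ ⟨g1, g2, g3⟩
  have h' := h.of_temp g1 g2
  refine Runs.cond (by omega) (fun hne => ?_) (fun heq => ?_)
  · rw [g3] at hne
    exact h'.runs_skip.mono (by omega) le_rfl fun q' hq' => h₁ hne q' hq'
  · rw [g3] at heq
    exact (h₀ heq q₁ h').mono (by omega) le_rfl fun _ h => h

/-- Insert the pair of the contents of `b` and `e`, unless the cell `3 * r_r + off` is occupied. -/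
def insertIfZero (off r b e : ℕ) : Cmd := ifZero off r (writePair b e e b)

/-- The word 0 can stand for absence because the stored components are positive and smaller than `2
^ w`. -/
theorem StoresPairs.start_eq_zero_iff {mem : BitVec w → BitVec w} {M : Set (ℕ × ℕ)}
    (h : StoresPairs mem M) (hM : ∀ p ∈ M, 1 ≤ p.1 ∧ p.1 ≤ p.2 ∧ p.2 < 2 ^ w) {b : ℕ}
    (hb : 3 * b + 2 < 2 ^ w) :
    mem (BitVec.ofNat w (3 * b + 1)) = 0 ↔ ∀ e, (b, e) ∉ M := by
  refine ⟨fun h0 e he => ?_, h.start_none b hb⟩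
  obtain ⟨h1, h2, h3⟩ := hM _ he
  rw [h.start_mem b e he hb, ofNat_eq_zero_of_lt h3] at h0
  simp only at h1 h2
  omega

theorem StoresPairs.end_eq_zero_iff {mem : BitVec w → BitVec w} {M : Set (ℕ × ℕ)}
    (h : StoresPairs mem M) (hM : ∀ p ∈ M, 1 ≤ p.1 ∧ p.1 ≤ p.2 ∧ p.2 < 2 ^ w) {e : ℕ}
    (he : 3 * e + 2 < 2 ^ w) :
    mem (BitVec.ofNat w (3 * e + 2)) = 0 ↔ ∀ b, (b, e) ∉ M := by
  refine ⟨fun h0 b hb => ?_, h.end_none e he⟩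
  obtain ⟨h1, h2, h3⟩ := hM _ hb
  rw [h.end_mem b e hb he, ofNat_eq_zero_of_lt (by omega)] at h0
  simp only at h1
  omega

theorem Stores.runs_insertIfZero_end {q s : State w} {v : ℕ → ℕ} {M : Set (ℕ × ℕ)}
    (h : Stores q s v M) (hM : ∀ p ∈ M, 1 ≤ p.1 ∧ p.1 ≤ p.2 ∧ p.2 < 2 ^ w)
    {b e m : ℕ} (hb : b < 13) (he : e < 13)
    (hbw : 3 * v b + 2 < 2 ^ w) (hew : 3 * v e + 2 < 2 ^ w) (hbm : 3 * v b + 3 ≤ m)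
    (hem : 3 * v e + 3 ≤ m) (h₁ : ∀ e', (v b, e') ∈ M → e' = v e) :
    Runs (insertIfZero 2 e b e) q 16 m
      (fun q' => Stores q' s v (M ∪ {p | (∀ x, (x, v e) ∉ M) ∧ p = (v b, v e)})) := by
  refine h.runs_ifZero (k := 10) he hew (by omega) (by omega) (fun h0 q' hq => ?_)
    (fun h0 q' hq => ?_)
  · rw [h.pairs.end_eq_zero_iff hM hew] at h0
    refine (hq.runs_insert hb he hbw hew hbm hem h₁ fun b' hb' => absurd hb' (h0 b')).mono
      le_rfl le_rfl fun q'' hq'' => ?_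
    convert hq'' using 1
    ext p
    simp [h0, or_comm]
  · rw [Ne, h.pairs.end_eq_zero_iff hM hew] at h0
    convert hq using 1
    ext p
    simp only [h0, false_and, Set.mem_union, Set.mem_ofPred_eq, or_false]

theorem Stores.runs_insertIfZero_start {q s : State w} {v : ℕ → ℕ} {M : Set (ℕ × ℕ)}
    (h : Stores q s v M) (hM : ∀ p ∈ M, 1 ≤ p.1 ∧ p.1 ≤ p.2 ∧ p.2 < 2 ^ w)
    {b e m : ℕ} (hb : b < 13) (he : e < 13)
    (hbw : 3 * v b + 2 < 2 ^ w) (hew : 3 * v e + 2 < 2 ^ w) (hbm : 3 * v b + 3 ≤ m)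
    (hem : 3 * v e + 3 ≤ m) (h₂ : ∀ b', (b', v e) ∈ M → b' = v b) :
    Runs (insertIfZero 1 b b e) q 16 m
      (fun q' => Stores q' s v (M ∪ {p | (∀ x, (v b, x) ∉ M) ∧ p = (v b, v e)})) := by
  refine h.runs_ifZero (k := 10) hb (by omega) (by omega) (by omega) (fun h0 q' hq => ?_)
    (fun h0 q' hq => ?_)
  · rw [h.pairs.start_eq_zero_iff hM hbw] at h0
    refine (hq.runs_insert hb he hbw hew hbm hem (fun e' he' => absurd he' (h0 e')) h₂).mono
      le_rfl le_rfl fun q'' hq'' => ?_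
    convert hq'' using 1
    ext p
    simp [h0, or_comm]
  · rw [Ne, h.pairs.start_eq_zero_iff hM hbw] at h0
    convert hq using 1
    ext p
    simp only [h0, false_and, Set.mem_union, Set.mem_ofPred_eq, or_false]

end Cells

/-! ### Editing the stored set around the copy of the shortest double suffix -/

section Maintenance

variable {w : ℕ}

/-- The minimal unique substrings of `T a` apart from a new one that is a suffix of `T a`. -/
def innerMUS {α : Type*} [DecidableEq α] (T : List α) (a : α) : Set (ℕ × ℕ) :=
  (MUS T \ {p | IsSSufCopy (T ++ [a]) p.1 p.2}) ∪
    {p | ∃ s q, IsSSufCopy (T ++ [a]) s q ∧ (∀ x, (x, q + 1) ∉ MUS T) ∧ p = (s, q + 1)} ∪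
    {p | ∃ s q, IsSSufCopy (T ++ [a]) s q ∧ 1 + lsuf (T ++ [a]) ≤ q ∧
      (∀ x, (q - lsuf (T ++ [a]), x) ∉ MUS T) ∧ p = (q - lsuf (T ++ [a]), q)}

theorem MUS_append_eq {α : Type*} [DecidableEq α] (T : List α) (a : α) :
    MUS (T ++ [a]) = innerMUS T a ∪
      {p | lsuf (T ++ [a]) ≤ lsuf T ∧ p = (T.length + 1 - lsuf (T ++ [a]), T.length + 1)} := by
  have h1 := MUS_diff_append T a
  have h2 := MUS_append_diff T a
  rw [innerMUS, ← h1]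
  ext p
  have h3 := Set.ext_iff.1 h2 p
  simp only [Set.mem_union, Set.mem_sdiff] at h3 ⊢
  tauto

theorem innerMUS_subset {α : Type*} [DecidableEq α] (T : List α) (a : α) :
    innerMUS T a ⊆ MUS (T ++ [a]) := by
  rw [MUS_append_eq]
  exact Set.subset_union_left

theorem innerMUS_of_not_exists {α : Type*} [DecidableEq α] {T : List α} {a : α}
    (h : ¬ ∃ l, IsSSuf (T ++ [a]) l) : innerMUS T a = MUS T := by
  rw [exists_isSSuf_iff] at h
  push Not at h
  ext p
  simp [innerMUS, h]

/-- Delete `[s..q]` and carry out the insertions `[s..q + 1]` and `[q - m..q]`, where `s`, `q`, `m`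
are in the registers `10`, `9`, `6`. -/
def editPairs : Cmd :=
  .seq (.const 4 0) (.seq (writePair 10 9 4 4) (.seq (.op .add 11 9 7)
    (.seq (insertIfZero 2 11 10 11) (.seq (.op .lt 12 6 9)
      (.cond 12 (.seq (.op .sub 12 9 6) (insertIfZero 1 12 12 9)) skip)))))

/-- The deletion comes first: it frees the start cell of `s` and the end cell of `q`, which the two
insertions then use. The step bound is 1 + 10 + 1 + 16 + 1 + 1 + 1 + 16. -/
theorem runs_editPairs {α : Type*} [DecidableEq α] {T : List α} {a : α} {s q m : ℕ}
    {Q S : State w} {v : ℕ → ℕ} (h : Stores Q S v (MUS T))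
    (hc : IsSSufCopy (T ++ [a]) s q) (hq : v 9 = q) (hs : v 10 = s) (h7 : v 7 = 1)
    (hv6 : v 6 = lsuf (T ++ [a])) (hw : 3 * T.length + 5 < 2 ^ w) (hm : 3 * T.length + 6 ≤ m) :
    Runs editPairs Q 47 m (fun Q' => ∃ v', Stores Q' S v' (innerMUS T a) ∧ v' 2 = v 2 ∧
      v' 6 = v 6 ∧ v' 8 = v 8) := by
  obtain ⟨hs1, hsq, hqT, -⟩ := isSSufCopy_append_iff.1 hc
  have hmT := lsuf_append_le (T := T) (a := a)
  have hle := hc.le_lsuf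
  have hmem := hc.mem_MUS
  have hpos : ∀ p ∈ MUS T, 1 ≤ p.1 ∧ p.1 ≤ p.2 ∧ p.2 < 2 ^ w := fun p hp =>
    ⟨hp.1, hp.2.1, by have := hp.2.2.1; omega⟩
  refine Runs.bind (h.runs_const (by omega)) (by omega) fun Q₁ hQ₁ => ?_
  refine Runs.bind (hQ₁.runs_erase (by omega) (by omega) (by omega) (by simp) ?_ ?_ ?_ ?_ ?_ ?_ ?_)
    (by omega) fun Q₂ hQ₂ => ?_
  · simp [hs]; omega
  · simp [hq]; omega
  · simp [hs]; omega
  · simp [hq]; omega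
  · simpa [hs, hq] using hmem
  · intro e' he'
    simp only [ne_eq, Nat.reduceEqDiff, not_false_eq_true, Function.update_of_ne, hs, hq] at he' ⊢
    exact MUS_start_unique he' hmem
  · intro b' hb'
    simp only [ne_eq, Nat.reduceEqDiff, not_false_eq_true, Function.update_of_ne, hs, hq] at hb' ⊢
    exact MUS_end_unique hb' hmem
  simp only [ne_eq, Nat.reduceEqDiff, not_false_eq_true, Function.update_of_ne, hs, hq] at hQ₂
  refine Runs.bind (hQ₂.runs_op (x := q + 1) (by omega) (by omega) (by omega) ?_) (by omega)
    fun Q₃ hQ₃ => ?_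
  · simp [hq, h7, BinOp.eval_add]
  have hpos₁ : ∀ p ∈ MUS T \ {(s, q)}, 1 ≤ p.1 ∧ p.1 ≤ p.2 ∧ p.2 < 2 ^ w :=
    fun p hp => hpos p hp.1
  refine Runs.bind (hQ₃.runs_insertIfZero_end hpos₁ (by omega) (by omega) ?_ ?_ ?_ ?_ ?_)
    (by omega) fun Q₄ hQ₄ => ?_
  · simp [hs]; omega
  · simp; omega
  · simp [hs]; omega
  · simp; omega
  · intro e' he'
    simp only [ne_eq, Nat.reduceEqDiff, not_false_eq_true, Function.update_of_ne, hs] at he'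
    exact absurd (by rw [MUS_start_unique he'.1 hmem]; rfl) he'.2
  simp only [ne_eq, Nat.reduceEqDiff, not_false_eq_true, Function.update_of_ne,
    Function.update_self, hs] at hQ₄
  generalize hM₂ : (MUS T \ {(s, q)}) ∪
    {p | (∀ x, (x, q + 1) ∉ MUS T \ {(s, q)}) ∧ p = (s, q + 1)} = M₂ at hQ₄
  have hpos₂ : ∀ p ∈ M₂, 1 ≤ p.1 ∧ p.1 ≤ p.2 ∧ p.2 < 2 ^ w := by
    rw [← hM₂]
    rintro p (hp | ⟨-, rfl⟩)
    · exact hpos₁ p hp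
    · exact ⟨hs1, by simp only; omega, by simp only; omega⟩
  have hiff : ∀ p, p ∈ innerMUS T a ↔ p ∈ M₂ ∨ (1 + lsuf (T ++ [a]) ≤ q ∧
      (∀ x, (q - lsuf (T ++ [a]), x) ∉ M₂) ∧ p = (q - lsuf (T ++ [a]), q)) := by
    rintro ⟨x, y⟩
    have e1 : ∀ x y, IsSSufCopy (T ++ [a]) x y ↔ x = s ∧ y = q := fun x y =>
      ⟨fun hxy => hxy.unique hc, fun ⟨hx, hy⟩ => hx ▸ hy ▸ hc⟩
    -- This test is made after the earlier edits, but they only concern pairs starting at `s`, and q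
    -- - m' < s because the shortest double suffix is no longer than LSuf(Ta).
    have e2 : 1 + lsuf (T ++ [a]) ≤ q → ((∀ x, (q - lsuf (T ++ [a]), x) ∉ M₂) ↔
        ∀ x, (q - lsuf (T ++ [a]), x) ∉ MUS T) := by
      intro hlt
      have hne : q - lsuf (T ++ [a]) ≠ s := by omega
      simp [← hM₂, hne]
    have e3 : 1 + lsuf (T ++ [a]) ≤ q ∧ (∀ x, (q - lsuf (T ++ [a]), x) ∉ M₂) ∧
        (x, y) = (q - lsuf (T ++ [a]), q) ↔ 1 + lsuf (T ++ [a]) ≤ q ∧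
        (∀ x, (q - lsuf (T ++ [a]), x) ∉ MUS T) ∧ (x, y) = (q - lsuf (T ++ [a]), q) :=
      and_congr_right fun hlt => and_congr_left fun _ => e2 hlt
    rw [e3, innerMUS, ← hM₂]
    simp only [e1, Set.mem_union, Set.mem_sdiff, Set.mem_ofPred_eq, Set.mem_singleton_iff,
      Prod.mk.injEq, and_assoc, exists_eq_left, exists_and_left]
    simp
  -- The comparison checks q - m' ≥ 1 before the subtraction, which would otherwise wrap around or
  -- give 0.
  refine Runs.bind (hQ₄.runs_op (x := if lsuf (T ++ [a]) < q then 1 else 0) (by omega) (by omega)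
    (by omega) ?_) (by omega) fun Q₅ hQ₅ => ?_
  · simp only [ne_eq, Nat.reduceEqDiff, not_false_eq_true, Function.update_of_ne, hv6, hq]
    exact BinOp.eval_lt (by omega) (by omega)
  have h12 := hQ₅.reg 12 (by omega)
  rw [Function.update_self] at h12
  refine Runs.cond (by omega) (fun hne => ?_) (fun heq => ?_)
  · have hlt : lsuf (T ++ [a]) < q := by
      by_contra hcon
      rw [h12, if_neg hcon] at hne
      exact hne rfl
    refine Runs.bind (hQ₅.runs_op (x := q - lsuf (T ++ [a])) (by omega) (by omega) (by omega) ?_)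
      (by omega) fun Q₆ hQ₆ => ?_
    · simp only [ne_eq, Nat.reduceEqDiff, not_false_eq_true, Function.update_of_ne, hv6, hq]
      exact BinOp.eval_sub hlt.le
    refine (hQ₆.runs_insertIfZero_start hpos₂ (by omega) (by omega) ?_ ?_ ?_ ?_ ?_).mono
      (by omega) le_rfl fun Q₇ hQ₇ => ?_
    · simp; omega
    · simp [hq]; omega
    · simp; omega
    · simp [hq]; omega
    · intro b' hb'
      simp only [ne_eq, Nat.reduceEqDiff, not_false_eq_true, Function.update_of_ne, hq,
        ← hM₂] at hb'
      rcases hb' with hb' | ⟨-, hb'⟩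
      · exact absurd (by rw [MUS_end_unique hb'.1 hmem]; rfl) hb'.2
      · simp at hb'
    refine ⟨_, hQ₇.congr (Set.ext fun p => ?_), ?_⟩
    · rw [hiff]
      simp [hq, show 1 + lsuf (T ++ [a]) ≤ q by omega]
    · simp
  · have hlt : ¬ lsuf (T ++ [a]) < q := by
      intro hcon
      rw [h12, if_pos hcon, ofNat_eq_zero_of_lt (by omega)] at heq
      omega
    refine hQ₅.runs_skip.mono (by omega) le_rfl fun Q₆ hQ₆ =>
      ⟨_, hQ₆.congr (Set.ext fun p => ?_), ?_⟩
    · rw [hiff]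
      refine (or_iff_left ?_).symm
      rintro ⟨h1, -⟩
      omega
    · simp

end Maintenance

/-! ### The update program and its cost -/

section Algorithm

variable {w : ℕ}

theorem Stores.runs_readCell {q s : State w} {v : ℕ → ℕ} {M : Set (ℕ × ℕ)} (h : Stores q s v M)
    {off d r m : ℕ} (hd : d < 13) (hr : r < 13) (hlt : 3 * v r + off < 2 ^ w)
    (hm : 3 * v r + off + 1 ≤ m) :
    Runs (readCell off d r) q 5 m (fun q' =>
      Stores q' s (Function.update v d (q.mem (BitVec.ofNat w (3 * v r + off))).toNat) M ∧
        q'.reg d = q.mem (BitVec.ofNat w (3 * v r + off))) := by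
  refine MUSOnline.runs_readCell (by omega) (h.reg r hr) hlt hm fun q' h1 h2 h3 => ⟨?_, h3⟩
  refine (h.setReg hd).of_temp (fun r' g1 g2 g3 => ?_) h2
  simp only [State.setReg, Function.update_apply]
  split_ifs with hrd
  · rw [hrd, h3, BitVec.ofNat_toNat, BitVec.setWidth_eq]
  · exact h1 r' hrd g2 g3

/-- The operations of an implementation of `SuffixUpdate` for the representation `Rep`. -/
structure TreeOps (P : SUProgram) (w σ N : ℕ) (t : ℕ → ℕ) (c : ℕ)
    (Rep : State w → List (BitVec w) → (List (Option (BitVec w)) → BitVec w) → Prop) : Prop where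
  update : ∀ s T addr a, Rep s T addr → T.length < N → a.toNat < σ →
    Runs P.update (s.setReg 0 a) (t (T.length + 1)) (c * (T.length + 2))
      (fun s' => ∃ addr', Rep s' (T ++ [a]) addr' ∧
        ∃ X B, IsInsertionPoint (some a) (invText T) X ∧ IsLowerNode (invText T) X B ∧
          s'.reg 0 = addr' B ∧ s'.reg 1 = BitVec.ofNat w X.length)
  parent : ∀ s T addr X Y, Rep s T addr → IsNode (invText T) X → IsParent (invText T) Y X →
    Runs P.parent (s.setReg 0 (addr X)) (t T.length) (c * (T.length + 1))
      (fun s' => Rep s' T addr ∧ s'.reg 0 = addr Y)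
  depth : ∀ s T addr X, Rep s T addr → IsNode (invText T) X →
    Runs P.depth (s.setReg 0 (addr X)) (t T.length) (c * (T.length + 1))
      (fun s' => Rep s' T addr ∧ s'.reg 0 = BitVec.ofNat w X.length)
  isLeaf : ∀ s T addr X, Rep s T addr → IsNode (invText T) X →
    Runs P.isLeaf (s.setReg 0 (addr X)) (t T.length) (c * (T.length + 1))
      (fun s' => Rep s' T addr ∧
        (IsLeaf (invText T) X → s'.reg 0 = 1) ∧ (¬ IsLeaf (invText T) X → s'.reg 0 = 0))

/-- Compute the copy `[s..q]` of the shortest double suffix from the lower end of the edge of the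
insertion point, and update the stored pairs. -/
def locateAndEdit (P : SUProgram) : Cmd :=
  .seq (call P.parent 5) (.seq (result 10 0) (.seq (call P.parent 10) (.seq (result 10 0)
    (.seq (call P.depth 10) (.seq (result 10 0) (.seq (.op .sub 9 9 7) (.seq (.op .sub 10 9 10)
      editPairs)))))))

/-- Update the suffix tree and collect the data of the insertion point. -/
def updateTree (P : SUProgram) : Cmd :=
  .seq (call P.update 0) (.seq (result 5 0) (.seq (result 6 1) (.seq (.const 7 1)
    (.seq (.op .add 2 2 7) (.seq (.op .lt 8 3 6) (.seq (call P.depth 5) (.seq (result 9 0)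
      (.op .eq 10 9 6))))))))

/-- The changes that are due to the shortest double suffix. -/
def updateInner (P : SUProgram) : Cmd :=
  .cond 10 skip (.seq (call P.isLeaf 5) (.seq (result 10 0) (.cond 10 (locateAndEdit P) skip)))

/-- The insertion of a suffix. -/
def updateLast : Cmd :=
  .seq (.cond 8 skip (.seq (.op .sub 11 2 6) (writePair 11 2 2 11))) (.op .or 3 6 6)

/-- Read one letter. -/
def readLetter (P : SUProgram) : Cmd :=
  .seq (updateTree P) (.seq (updateInner P) updateLast)

/-- The programs that maintain the minimal unique substrings. -/
def musProgram (P : SUProgram) : MUSProgram where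
  init := call P.init 0
  update := readLetter P
  byStart := readCell 1 0 0
  byEnd := readCell 2 0 0

theorem ofNat_toNat_self (x : BitVec w) : BitVec.ofNat w x.toNat = x := by
  rw [BitVec.ofNat_toNat, BitVec.setWidth_eq]

/-- In the new tree the parent of `B` is `X` and the parent of `X` is `Y`, so three queries yield
|Y|; then q = |B| - 1 and s = q - |Y|. -/
theorem runs_locateAndEdit {P : SUProgram} {σ N : ℕ} {t : ℕ → ℕ} {c : ℕ}
    {Rep : State w → List (BitVec w) → (List (Option (BitVec w)) → BitVec w) → Prop}
    (hP : TreeOps P w σ N t c Rep) {T : List (BitVec w)} {a : BitVec w}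
    {addr : List (Option (BitVec w)) → BitVec w} {B : List (Option (BitVec w))}
    {Q S : State w} {v : ℕ → ℕ} {m : ℕ} (h : Stores Q S v (MUS T))
    (hS : Rep S (T ++ [a]) addr) (hn : ¬ IsNode (invText T) (lsufLocus T a))
    (hB : IsLowerNode (invText T) (lsufLocus T a) B) (hl : IsLeaf (invText T) B)
    (h5 : v 5 = (addr B).toNat) (h6 : v 6 = lsuf (T ++ [a])) (h7 : v 7 = 1)
    (h9 : v 9 = B.length) (hcw : 3 * (c * (T.length + 2)) ≤ 2 ^ w)
    (hcm : 3 * (c * (T.length + 2)) ≤ m)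
    (hw : 3 * T.length + 5 < 2 ^ w) (hm : 3 * T.length + 6 ≤ m) :
    Runs (locateAndEdit P) Q (9 * t (T.length + 1) + 60) m (fun Q' => ∃ S' v',
      Stores Q' S' v' (innerMUS T a) ∧ Rep S' (T ++ [a]) addr ∧ v' 2 = v 2 ∧ v' 6 = v 6 ∧
        v' 8 = v 8) := by
  have hX := isNode_append_lsufLocus T a
  obtain ⟨Y, hY⟩ := exists_isParent (S := invText (T ++ [a])) (X := lsufLocus T a)
    fun h => hn (Or.inl h)
  obtain ⟨hc, hle⟩ := isSSufCopy_of_isLeaf hn hB hY hl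
  have hB' : IsNode (invText (T ++ [a])) B := by
    rw [invText_append]
    exact hB.1.cons
  have hXB : IsParent (invText (T ++ [a])) (lsufLocus T a) B := by
    have hX' := hX
    rw [invText_append] at hX' ⊢
    exact hB.isParent (isInsertionPoint_lsufLocus T a) hn hX'
  have hlen : (T ++ [a]).length = T.length + 1 := by simp
  refine Runs.bind (h.runs_call (p := P.parent) (by omega) (by
    rw [h5, ofNat_toNat_self]
    exact hP.parent S _ addr _ _ hS hB' hXB) (by rwa [hlen]) (by rwa [hlen])) (by rw [hlen]; omega) ?_
  rintro Q₁ ⟨S₁, hQ₁, hS₁, hr₁⟩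
  refine Runs.bind (hQ₁.runs_result (d := 10) (by omega) (by rw [hr₁, ofNat_toNat_self]))
    (by rw [hlen]; omega) fun Q₂ hQ₂ => ?_
  refine Runs.bind (hQ₂.runs_call (p := P.parent) (by omega) (by
    rw [Function.update_self, ofNat_toNat_self]
    exact hP.parent S₁ _ addr _ _ hS₁ hX hY) (by rwa [hlen]) (by rwa [hlen])) (by rw [hlen]; omega) ?_
  rintro Q₃ ⟨S₃, hQ₃, hS₃, hr₃⟩
  refine Runs.bind (hQ₃.runs_result (d := 10) (by omega) (by rw [hr₃, ofNat_toNat_self]))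
    (by rw [hlen]; omega) fun Q₄ hQ₄ => ?_
  refine Runs.bind (hQ₄.runs_call (p := P.depth) (by omega) (by
    rw [Function.update_self, ofNat_toNat_self]
    exact hP.depth S₃ _ addr _ hS₃ hY.1) (by rwa [hlen]) (by rwa [hlen])) (by rw [hlen]; omega) ?_
  rintro Q₅ ⟨S₅, hQ₅, hS₅, hr₅⟩
  refine Runs.bind (hQ₅.runs_result (d := 10) (by omega) hr₅)
    (by rw [hlen]; omega) fun Q₆ hQ₆ => ?_
  refine Runs.bind (hQ₆.runs_op (x := B.length - 1) (by omega) (by omega) (by omega) ?_)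
    (by rw [hlen]; omega) fun Q₇ hQ₇ => ?_
  · simp only [ne_eq, Nat.reduceEqDiff, not_false_eq_true, Function.update_of_ne, h9, h7]
    exact BinOp.eval_sub (by omega)
  refine Runs.bind (hQ₇.runs_op (x := B.length - 1 - Y.length) (by omega) (by omega) (by omega) ?_)
    (by rw [hlen]; omega) fun Q₈ hQ₈ => ?_
  · simp only [ne_eq, Nat.reduceEqDiff, not_false_eq_true, Function.update_of_ne,
      Function.update_self]
    exact BinOp.eval_sub (by omega)
  refine (runs_editPairs hQ₈ hc (by simp) (by simp) (by simp [h7]) (by simp [h6]) hw hm).mono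
    (by rw [hlen]; omega) le_rfl ?_
  rintro Q₉ ⟨v', h1, h2, h3, h4⟩
  exact ⟨S₅, v', h1, hS₅, by simp [h2], by simp [h3], by simp [h4]⟩

/-- The state `q` stores the data structure for the text `T`. -/
def MUSRep (N : ℕ) (Rep : State w → List (BitVec w) → (List (Option (BitVec w)) → BitVec w) → Prop)
    (q : State w) (T : List (BitVec w)) : Prop :=
  ∃ s addr v, Stores q s v (MUS T) ∧ Rep s T addr ∧ v 2 = T.length ∧ v 3 = lsuf T ∧ T.length ≤ N

theorem lsuf_le_length {α : Type*} [DecidableEq α] (T : List α) : lsuf T ≤ T.length :=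
  Nat.findGreatest_le _

/-- Register 2 holds the text length, 3 the old `lsuf`, 5 the pointer to `B`, 6 the new `lsuf`, 8
whether `lsuf` has grown, 9 the depth of `B`, and 10 whether `B` is the insertion point. -/
theorem runs_updateTree {P : SUProgram} {σ N : ℕ} {t : ℕ → ℕ} {c : ℕ}
    {Rep : State w → List (BitVec w) → (List (Option (BitVec w)) → BitVec w) → Prop}
    (hP : TreeOps P w σ N t c Rep) {T : List (BitVec w)} {a : BitVec w} {Q : State w} {m : ℕ}
    (h : MUSRep N Rep Q T) (hT : T.length < N) (ha : a.toNat < σ)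
    (hcw : 3 * (c * (T.length + 2)) ≤ 2 ^ w) (hcm : 3 * (c * (T.length + 2)) ≤ m)
    (hw : 3 * T.length + 5 < 2 ^ w) :
    Runs (updateTree P) (Q.setReg 0 a) (6 * t (T.length + 1) + 9) m
      (fun Q' => ∃ S addr B u, Stores Q' S u (MUS T) ∧ Rep S (T ++ [a]) addr ∧
        IsLowerNode (invText T) (lsufLocus T a) B ∧ u 2 = T.length + 1 ∧ u 5 = (addr B).toNat ∧
        u 6 = lsuf (T ++ [a]) ∧ u 7 = 1 ∧ (u 8 = if lsuf T < lsuf (T ++ [a]) then 1 else 0) ∧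
        u 9 = B.length ∧ (u 10 = if B.length = lsuf (T ++ [a]) then 1 else 0)) := by
  obtain ⟨S, addr₀, v, h, hS, hv2, hv3, -⟩ := h
  have hlen : (T ++ [a]).length = T.length + 1 := by simp
  have hmT := lsuf_append_le (T := T) (a := a)
  have hmT' := lsuf_le_length T
  have hQ₀ := h.setReg (d := 0) (x := a.toNat) (by omega)
  rw [ofNat_toNat_self] at hQ₀
  refine Runs.bind (hQ₀.runs_call (p := P.update) (by omega) (by
    rw [Function.update_self, ofNat_toNat_self]
    exact hP.update S T addr₀ a hS hT ha) hcw hcm) (by omega) ?_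
  rintro Q₁ ⟨S₁, hQ₁, addr, hS₁, X, B, hX, hB, hr0, hr1⟩
  obtain rfl := hX.unique (isInsertionPoint_lsufLocus T a)
  rw [length_lsufLocus] at hr1
  have hB' : IsNode (invText (T ++ [a])) B := by
    rw [invText_append]
    exact hB.1.cons
  have hBlen := hB.1.isInfix.length_le
  rw [length_invText] at hBlen
  refine Runs.bind (hQ₁.runs_result (d := 5) (by omega) (hr0.trans (ofNat_toNat_self _).symm))
    (by omega) fun Q₂ hQ₂ => ?_
  refine Runs.bind (hQ₂.runs_result (d := 6) (by omega) hr1) (by omega) fun Q₃ hQ₃ => ?_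
  refine Runs.bind (hQ₃.runs_const (d := 7) (n := 1) (by omega)) (by omega) fun Q₄ hQ₄ => ?_
  refine Runs.bind (hQ₄.runs_op (d := 2) (x := T.length + 1) (by omega) (by omega) (by omega) ?_)
    (by omega) fun Q₅ hQ₅ => ?_
  · simp [hv2, BinOp.eval_add]
  refine Runs.bind (hQ₅.runs_op (d := 8) (x := if lsuf T < lsuf (T ++ [a]) then 1 else 0)
    (by omega) (by omega) (by omega) ?_) (by omega) fun Q₆ hQ₆ => ?_
  · simp only [ne_eq, Nat.reduceEqDiff, not_false_eq_true, Function.update_of_ne,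
      Function.update_self, hv3]
    exact BinOp.eval_lt (by omega) (by omega)
  refine Runs.bind (hQ₆.runs_call (p := P.depth) (r := 5) (by omega) (by
    simp only [ne_eq, Nat.reduceEqDiff, not_false_eq_true, Function.update_of_ne,
      Function.update_self, ofNat_toNat_self]
    exact hP.depth S₁ _ addr _ hS₁ hB') (by rwa [hlen]) (by rwa [hlen])) (by rw [hlen]; omega) ?_
  rintro Q₇ ⟨S₇, hQ₇, hS₇, hr₇⟩
  refine Runs.bind (hQ₇.runs_result (d := 9) (by omega) hr₇)
    (by rw [hlen]; omega) fun Q₈ hQ₈ => ?_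
  refine (hQ₈.runs_op (d := 10) (x := if B.length = lsuf (T ++ [a]) then 1 else 0)
    (by omega) (by omega) (by omega) ?_).mono (by rw [hlen]; omega) le_rfl fun Q₉ hQ₉ => ?_
  · simp only [ne_eq, Nat.reduceEqDiff, not_false_eq_true, Function.update_of_ne,
      Function.update_self]
    exact BinOp.eval_eq (by omega) (by omega)
  exact ⟨S₇, addr, B, _, hQ₉, hS₇, hB, by simp, by simp, by simp, by simp, by simp, by simp, by simp⟩

theorem runs_updateInner {P : SUProgram} {σ N : ℕ} {t : ℕ → ℕ} {c : ℕ}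
    {Rep : State w → List (BitVec w) → (List (Option (BitVec w)) → BitVec w) → Prop}
    (hP : TreeOps P w σ N t c Rep) {T : List (BitVec w)} {a : BitVec w}
    {addr : List (Option (BitVec w)) → BitVec w} {B : List (Option (BitVec w))}
    {Q S : State w} {v : ℕ → ℕ} {m : ℕ} (h : Stores Q S v (MUS T))
    (hS : Rep S (T ++ [a]) addr) (hB : IsLowerNode (invText T) (lsufLocus T a) B)
    (h5 : v 5 = (addr B).toNat) (h6 : v 6 = lsuf (T ++ [a])) (h7 : v 7 = 1)
    (h9 : v 9 = B.length) (h10 : v 10 = if B.length = lsuf (T ++ [a]) then 1 else 0)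
    (hcw : 3 * (c * (T.length + 2)) ≤ 2 ^ w)
    (hcm : 3 * (c * (T.length + 2)) ≤ m)
    (hw : 3 * T.length + 5 < 2 ^ w) (hm : 3 * T.length + 6 ≤ m) :
    Runs (updateInner P) Q (12 * t (T.length + 1) + 64) m (fun Q' => ∃ S' v',
      Stores Q' S' v' (innerMUS T a) ∧ Rep S' (T ++ [a]) addr ∧ v' 2 = v 2 ∧ v' 6 = v 6 ∧
        v' 8 = v 8) := by
  have hlen : (T ++ [a]).length = T.length + 1 := by simp
  have hB' : IsNode (invText (T ++ [a])) B := by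
    rw [invText_append]
    exact hB.1.cons
  have hBlen := hB.1.isInfix.length_le
  rw [length_invText] at hBlen
  have hr10 := h.reg 10 (by omega)
  rw [h10] at hr10
  -- Whether `X` was a node of the old tree can thus be decided after the update, since string
  -- depths do not change.
  have hnode : B.length = lsuf (T ++ [a]) ↔ IsNode (invText T) (lsufLocus T a) := by
    rw [← length_lsufLocus]
    constructor
    · intro he
      rw [hB.2.1.eq_of_length he.symm]
      exact hB.1
    · intro hn
      exact congrArg List.length ((hB.2.2 _ hn List.prefix_rfl).eq_of_length_le hB.2.1.length_le)
  refine Runs.cond (by omega) (fun hne => ?_) (fun heq => ?_)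
  · have hn : IsNode (invText T) (lsufLocus T a) := by
      rw [← hnode]
      by_contra hcon
      rw [hr10, if_neg hcon] at hne
      exact hne rfl
    refine h.runs_skip.mono (by omega) le_rfl fun Q' hQ' => ⟨S, v, hQ'.congr ?_, hS, rfl, rfl, rfl⟩
    rw [innerMUS_of_not_exists (not_exists_isSSuf_of_isNode hn)]
  have hn : ¬ IsNode (invText T) (lsufLocus T a) := by
    intro hcon
    rw [← hnode] at hcon
    rw [hr10, if_pos hcon, ofNat_eq_zero_of_lt (by omega)] at heq
    omega
  refine Runs.bind (h.runs_call (p := P.isLeaf) (by omega) (by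
    rw [h5, ofNat_toNat_self]
    exact hP.isLeaf S _ addr _ hS hB') (by rwa [hlen]) (by rwa [hlen])) (by rw [hlen]; omega) ?_
  rintro Q₁ ⟨S₁, hQ₁, hS₁, hr₁, hr₁'⟩
  -- The query refers to the new tree, but `B` is too short to be its additional leaf.
  rw [invText_append, isLeaf_cons_iff (by rwa [length_invText])] at hr₁ hr₁'
  refine Runs.bind (hQ₁.runs_result (d := 10) (by omega) (ofNat_toNat_self _).symm)
    (by rw [hlen]; omega) fun Q₂ hQ₂ => ?_
  have h2 := hQ₂.reg 10 (by omega)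
  rw [Function.update_self, ofNat_toNat_self] at h2
  refine Runs.cond (by rw [hlen]; omega) (fun hne => ?_) (fun heq => ?_)
  · have hl : IsLeaf (invText T) B := by
      by_contra hcon
      exact hne (h2.trans (hr₁' hcon))
    refine (runs_locateAndEdit hP hQ₂ hS₁ hn hB hl (by simp [h5]) (by simp [h6]) (by simp [h7])
      (by simp [h9]) hcw hcm hw hm).mono (by rw [hlen]; omega) le_rfl ?_
    rintro Q₃ ⟨S₃, v₃, g1, g2, g3, g4, g5⟩
    exact ⟨S₃, v₃, g1, g2, by simp [g3], by simp [g4], by simp [g5]⟩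
  · have hl : ¬ IsLeaf (invText T) B := by
      intro hcon
      have := heq.symm.trans (h2.trans (hr₁ hcon))
      -- The words 0 and 1 coincide for `w = 0`, which the size bound excludes.
      have h3 : (0 : BitVec w) ≠ BitVec.ofNat w 1 := fun hc =>
        one_ne_zero ((ofNat_eq_zero_of_lt (by omega)).1 hc.symm)
      exact h3 this
    refine hQ₂.runs_skip.mono (by rw [hlen]; omega) le_rfl fun Q₃ hQ₃ =>
      ⟨S₁, _, hQ₃.congr ?_, hS₁, by simp, by simp, by simp⟩
    rw [innerMUS_of_not_exists]
    rwa [exists_isSSuf_iff_isLeaf hn hB]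

theorem runs_updateLast {T : List (BitVec w)} {a : BitVec w} {Q S : State w} {v : ℕ → ℕ} {m : ℕ}
    (h : Stores Q S v (innerMUS T a)) (h2 : v 2 = T.length + 1) (h6 : v 6 = lsuf (T ++ [a]))
    (h8 : v 8 = if lsuf T < lsuf (T ++ [a]) then 1 else 0)
    (hw : 3 * T.length + 5 < 2 ^ w) (hm : 3 * T.length + 6 ≤ m) :
    Runs updateLast Q 13 m (fun Q' => ∃ v', Stores Q' S v' (MUS (T ++ [a])) ∧
      v' 2 = T.length + 1 ∧ v' 3 = lsuf (T ++ [a])) := by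
  have hmT := lsuf_append_le (T := T) (a := a)
  have hr8 := h.reg 8 (by omega)
  rw [h8] at hr8
  have key : Runs (.cond 8 skip (.seq (.op .sub 11 2 6) (writePair 11 2 2 11))) Q 12 m
      (fun Q' => ∃ v', Stores Q' S v' (MUS (T ++ [a])) ∧ v' 2 = v 2 ∧ v' 6 = v 6) := by
    refine Runs.cond (by omega) (fun hne => ?_) (fun heq => ?_)
    · have hlt : lsuf T < lsuf (T ++ [a]) := by
        by_contra hcon
        rw [hr8, if_neg hcon] at hne
        exact hne rfl
      refine h.runs_skip.mono (by omega) le_rfl fun Q' hQ' => ⟨v, hQ'.congr ?_, rfl, rfl⟩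
      rw [MUS_append_eq, eq_comm]
      refine Set.union_eq_left.2 ?_
      rintro p ⟨hp, -⟩
      omega
    · have hle : lsuf (T ++ [a]) ≤ lsuf T := by
        by_contra hcon
        rw [hr8, if_pos (by omega), ofNat_eq_zero_of_lt (by omega)] at heq
        omega
      have hmem := mem_MUS_append_last hle
      refine Runs.bind (h.runs_op (x := T.length + 1 - lsuf (T ++ [a])) (by omega) (by omega)
        (by omega) ?_) (by omega) fun Q₁ hQ₁ => ?_
      · rw [h2, h6]
        exact BinOp.eval_sub (by omega)
      refine (hQ₁.runs_insert (by omega) (by omega) ?_ ?_ ?_ ?_ ?_ ?_).mono (by omega) le_rfl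
        fun Q₂ hQ₂ => ⟨_, hQ₂.congr ?_, by simp, by simp⟩
      · simp; omega
      · simp [h2]; omega
      · simp; omega
      · simp [h2]; omega
      -- All pairs involved lie in `MUS (T ++ [a])`, where starts and ends determine intervals, so
      -- no cell is overwritten by a different pair.
      · intro e' he'
        simp only [ne_eq, Nat.reduceEqDiff, not_false_eq_true, Function.update_of_ne,
          Function.update_self, h2] at he' ⊢
        exact MUS_start_unique (innerMUS_subset T a he') hmem
      · intro b' hb'
        simp only [ne_eq, Nat.reduceEqDiff, not_false_eq_true, Function.update_of_ne,
          Function.update_self, h2] at hb' ⊢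
        exact MUS_end_unique (innerMUS_subset T a hb') hmem
      · rw [MUS_append_eq]
        ext p
        simp [h2, hle, or_comm]
  refine Runs.bind key (by omega) ?_
  rintro Q₁ ⟨v₁, h1, g2, g6⟩
  refine (h1.runs_op (x := lsuf (T ++ [a])) (by omega) (by omega) (by omega) ?_).mono
    (by omega) le_rfl fun Q₂ hQ₂ => ⟨_, hQ₂, by simp [g2, h2], by simp⟩
  rw [BinOp.eval_or_self, g6, h6]

theorem runs_readLetter {P : SUProgram} {σ N : ℕ} {t : ℕ → ℕ} {c : ℕ}
    {Rep : State w → List (BitVec w) → (List (Option (BitVec w)) → BitVec w) → Prop}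
    (hP : TreeOps P w σ N t c Rep) {T : List (BitVec w)} {a : BitVec w} {Q : State w} {m : ℕ}
    (h : MUSRep N Rep Q T) (hT : T.length < N) (ha : a.toNat < σ)
    (hcw : 3 * (c * (T.length + 2)) ≤ 2 ^ w) (hcm : 3 * (c * (T.length + 2)) ≤ m)
    (hw : 3 * T.length + 5 < 2 ^ w) (hm : 3 * T.length + 6 ≤ m) :
    Runs (readLetter P) (Q.setReg 0 a) (18 * t (T.length + 1) + 86) m
      (fun Q' => MUSRep N Rep Q' (T ++ [a])) := by
  refine Runs.bind (runs_updateTree hP h hT ha hcw hcm hw) (by omega) ?_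
  rintro Q₁ ⟨S, addr, B, v, hQ, hS, hB, h2, h5, h6, h7, h8, h9, h10⟩
  refine Runs.bind (runs_updateInner hP hQ hS hB h5 h6 h7 h9 h10 hcw hcm hw hm) (by omega) ?_
  rintro Q₂ ⟨S', v', hQ', hS', g2, g6, g8⟩
  refine (runs_updateLast hQ' (g2.trans h2) (g6.trans h6) (g8.trans h8) hw hm).mono
    (by omega) le_rfl ?_
  rintro Q₃ ⟨u, hu, u2, u3⟩
  exact ⟨S', addr, u, hu, hS', by simp [u2], u3, by simp; omega⟩

theorem MUS_nil {α : Type*} [DecidableEq α] : MUS ([] : List α) = ∅ := by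
  refine Set.eq_empty_of_forall_notMem ?_
  rintro ⟨s, t⟩ ⟨h1, h2, h3, -⟩
  simp only [List.length_nil] at h1 h2 h3
  omega

/-- Zeroed memory already encodes the empty set, and zeroed registers the length and `lsuf` of the
empty text, so only `P` has to be initialized. -/
theorem stores_zero (x : ℕ) : Stores ((State.zero w).setReg 0 (BitVec.ofNat w x)) (State.zero w)
    (Function.update (fun _ => 0) 0 x) ∅ :=
  Stores.setReg (v := fun _ => 0) ⟨⟨fun _ => rfl, fun _ _ => rfl⟩, fun _ _ => rfl,
    ⟨by simp, fun _ _ _ => rfl, by simp, fun _ _ _ => rfl⟩⟩ (by omega)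

/-- The constant 200 is generous: a letter costs at most 18t + 86 ≤ 104t steps, as t ≥ 1, and the
cells used stay below both 3c(n+1) and 3(n+1) or the larger of the two. -/
theorem maintainsMUS_musProgram {P : SUProgram} {σ N : ℕ} {t : ℕ → ℕ} {c : ℕ}
    (hw : 200 * (c + 1) * (N + 1) ≤ 2 ^ w) (hP : ImplementsSuffixUpdate P w σ N t c) :
    MaintainsMUS (musProgram P) w σ N (fun n => 200 * t n) (200 * (c + 1)) 200 := by
  obtain ⟨Rep, -, hinit, hupd, hpar, hdep, hleaf⟩ := hP
  have hops : TreeOps P w σ N t c Rep := ⟨hupd, hpar, hdep, hleaf⟩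
  have hexp : ∀ n, 200 * (c + 1) * (n + 1) = 200 * (c * (n + 1)) + 200 * n + 200 := fun n => by ring
  have hmono : ∀ n, n ≤ N → c * (n + 1) ≤ c * (N + 1) := fun n hn =>
    Nat.mul_le_mul_left c (by omega)
  rw [hexp] at hw
  have hc1 := hmono 0 (Nat.zero_le _)
  refine ⟨MUSRep N Rep, ?_, ?_, ?_, ?_⟩
  · have hone := hinit.one_le_steps
    refine ((stores_zero σ).runs_call (p := P.init) (r := 0) (by omega) (by simpa using hinit)
      (by omega) le_rfl).mono (by beta_reduce; omega) (by omega) ?_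
    rintro Q' ⟨S', hQ', addr, hS'⟩
    exact ⟨S', addr, _, hQ'.congr MUS_nil.symm, hS', by simp, by simp [lsuf], Nat.zero_le _⟩
  · intro Q T a h hT ha
    have hone : 1 ≤ t (T.length + 1) := by
      obtain ⟨S, addr, v, -, hS, -⟩ := h
      exact (hupd S T addr a hS hT ha).one_le_steps
    have h1 := hmono (T.length + 1) (by omega)
    have h2 := hexp (T.length + 1)
    rw [show T.length + 1 + 1 = T.length + 2 by ring] at h1 h2
    exact (runs_readLetter hops h hT ha (by omega) (m := 200 * (c + 1) * (T.length + 2))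
      (by omega) (by omega) (by omega)).mono (by beta_reduce; omega) le_rfl fun _ h => h
  · rintro Q T i ⟨S, addr, v, hQ, hS, h2, h3, hN⟩ h1i hiT
    have h2' := hexp T.length
    refine ((hQ.setReg (d := 0) (x := i) (by omega)).runs_readCell (m := 200 * (c + 1) *
      (T.length + 1)) (by omega) (by omega) ?_ ?_).mono (by omega) le_rfl ?_
    · simp; omega
    · simp; omega
    · rintro Q' ⟨hQ', hr⟩
      rw [Function.update_self] at hr
      refine ⟨⟨S, addr, _, hQ', hS, by simp [h2], by simp [h3], hN⟩, fun e he => ?_, fun hn => ?_⟩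
      · exact hr.trans (hQ.pairs.start_mem i e he (by omega))
      · exact hr.trans (hQ.pairs.start_none i (by omega) hn)
  · rintro Q T i ⟨S, addr, v, hQ, hS, h2, h3, hN⟩ h1i hiT
    have h2' := hexp T.length
    refine ((hQ.setReg (d := 0) (x := i) (by omega)).runs_readCell (m := 200 * (c + 1) *
      (T.length + 1)) (by omega) (by omega) ?_ ?_).mono (by omega) le_rfl ?_
    · simp; omega
    · simp; omega
    · rintro Q' ⟨hQ', hr⟩
      rw [Function.update_self] at hr
      refine ⟨⟨S, addr, _, hQ', hS, by simp [h2], by simp [h3], hN⟩, fun b hb => ?_, fun hn => ?_⟩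
      · exact hr.trans (hQ.pairs.end_mem b i hb (by omega))
      · exact hr.trans (hQ.pairs.end_none i (by omega) hn)

end Algorithm

end MUSOnline

theorem mainTheorem6 :
    -- changes of the set of minimal unique substrings when a letter is appended
    (∀ (α : Type*) [DecidableEq α] (T : List α) (a : α),
      MUS T \ MUS (T ++ [a]) = {p | IsSSufCopy (T ++ [a]) p.1 p.2} ∧
      MUS (T ++ [a]) \ MUS T =
        {p | lsuf (T ++ [a]) ≤ lsuf T ∧ p = (T.length + 1 - lsuf (T ++ [a]), T.length + 1)} ∪
        {p | ∃ s q, IsSSufCopy (T ++ [a]) s q ∧ (∀ x, (x, q + 1) ∉ MUS T) ∧ p = (s, q + 1)} ∪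
        {p | ∃ s q, IsSSufCopy (T ++ [a]) s q ∧ 1 + lsuf (T ++ [a]) ≤ q ∧
          (∀ x, (q - lsuf (T ++ [a]), x) ∉ MUS T) ∧ p = (q - lsuf (T ++ [a]), q)} ∧
      (MUS T \ MUS (T ++ [a])).encard ≤ 1 ∧
      ((MUS T \ MUS (T ++ [a])).encard = 1 ↔ ∃ l, IsSSuf (T ++ [a]) l) ∧
      (MUS (T ++ [a]) \ MUS T).encard ≤ 3 ∧
      -- reading off the two suffixes at the insertion point in the suffix tree
      ∃ X, IsInsertionPoint (some a) (invText T) X ∧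
        X = (suf (T ++ [a]) (lsuf (T ++ [a]))).reverse.map some ∧
        (IsNode (invText T) X → ¬ ∃ l, IsSSuf (T ++ [a]) l) ∧
        (¬ IsNode (invText T) X →
          IsNode (invText (T ++ [a])) X ∧
          ∃ B Y, IsLowerNode (invText T) X B ∧ IsParent (invText (T ++ [a])) Y X ∧
            ((∃ l, IsSSuf (T ++ [a]) l) ↔ IsLeaf (invText T) B) ∧
            (IsLeaf (invText T) B →
              IsSSuf (T ++ [a]) (Y.length + 1) ∧
              (suf (T ++ [a]) (Y.length + 1)).reverse.map some <+: X ∧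
              IsSSufCopy (T ++ [a]) (B.length - 1 - Y.length) (B.length - 1)))) ∧
    -- the online algorithm
    (∃ C : ℕ, ∀ P : SUProgram, ∃ Q : MUSProgram, ∀ (w σ N : ℕ) (t : ℕ → ℕ) (c : ℕ),
      C * (c + 1) * (N + 1) ≤ 2 ^ w →
      ImplementsSuffixUpdate P w σ N t c →
      MaintainsMUS Q w σ N (fun n => C * t n) (C * (c + 1)) C) := by
  refine ⟨fun α _ T a => ⟨MUS_diff_append T a, MUS_append_diff T a,
    encard_MUS_diff_append_le T a, encard_MUS_diff_append_eq_one_iff T a,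
    encard_MUS_append_diff_le T a, reading_off_suffixes T a⟩, 200, fun P => ⟨musProgram P, ?_⟩⟩
  intro w σ N t c hw hP
  exact maintainsMUS_musProgram hw hP
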